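/- Let $\mathbb K$ be a field of characteristic zero. **Graphs.** An admissible directed graph with $n\ge 1$ external vertices is a finite directed graph with external vertices labeled $1,\dots,n$, finitely many unlabeled internal vertices and a linear order on its set of edges, such that: there are no loops and no two edges with the same source and the same target (two edges of opposite directions are allowed); every internal vertex has at most one incoming and at most two outgoing edges; every internal vertex is connected with some external vertex by an undirected path. Let $\mathsf{dgr}(n)$ be the vector space spanned by these graphs modulo $\Gamma^\sigma=\operatorname{sgn}(\sigma)\Gamma$, where $\Gamma^\sigma$ is obtained from $\Gamma$ by a permutation $\sigma$ of the order of edges. In all sums below graphs that are not admissible are discarded. *Generalized IHX relations.* Let $\Gamma$ be a graph which is admissible, except that one internal vertex $v$ may have three outgoing edges instead of at most two. Replace $v$ by two internal vertices connected by a new directed edge, placed last in the order, and sum over all ways of reconnecting the edges previously adjacent to $v$ to these two vertices. Let $\mathsf{dgraphs}(n)$ be the quotient of $\mathsf{dgr}(n)$ by the span of all such sums. It is graded by $|\Gamma|=2\,\#\{\text{internal vertices}\}-\#\{\text{edges}\}$. *Insertion.* For graphs $\Gamma_1,\Gamma_2$ with $n$ and $m$ external vertices and $1\le i\le n$, let $\Gamma_1\circ_i\Gamma_2$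 be the element of $\mathsf{dgraphs}(n+m-1)$ obtained by replacing the $i$-th external vertex of $\Gamma_1$ by $\Gamma_2$ and summing over all ways of reconnecting the edges previously adjacent to $i$ to (internal or external) vertices of $\Gamma_2$; the edges of $\Gamma_1$ come before those of $\Gamma_2$. This is well defined on $\mathsf{dgraphs}$. **Lie algebra.** Let $\mathfrak g_{\mathsf{As},\mathsf{dgraphs}}=\prod_{n\ge1}s^{-n+1}\mathsf{dgraphs}(n)$, where an element $\Gamma\in\mathsf{dgraphs}(n)$ of degree $|\Gamma|$ has total degree $|\Gamma|+n-1$. For $\Gamma_1\in\mathsf{dgraphs}(n)$ and homogeneous $\Gamma_2\in\mathsf{dgraphs}(m)$ put $$\Gamma_1\star\Gamma_2=\sum_{i=1}^n(-1)^{|\Gamma_2|(1-n)+(i+1)(m-1)}\,\Gamma_1\circ_i\Gamma_2,$$ extended to the product, and $[x,y]=x\star y-(-1)^{kl}\,y\star x$ for $x,y$ of total degrees $k,l$. For $\alpha$ of total degree one with $[\alpha,\alpha]=0$ put $\mathrm{ad}_\alpha=[\alpha,-]$ and $$H^k(\mathfrak g_{\mathsf{As},\mathsf{dgraphs}},\mathrm{ad}_\alpha)=\ker(\mathrm{ad}_\alpha|_{\mathfrak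 g^k})/\mathrm{ad}_\alpha(\mathfrak g^{k-1}).$$ **The elements.** Let $a_1\in\mathsf{dgraphs}(1)$ be the sum of the two graphs with one external vertex, one internal vertex and one edge joining them. Let $a_2\in\mathsf{dgraphs}(2)$ be the graph with two external vertices, no internal vertex and no edge. Let $b=b_1+b_2+b_3\in\mathsf{dgraphs}(3)$, where $b_i$ is the graph with one internal vertex $v$ and three edges, the $k$-th edge ($k=1,2,3$) joining $v$ with the external vertex $k$, the $i$-th edge being directed towards $v$ and the two others away from $v$. **Lemma.** The element $b$ represents a non-trivial class in $H^1(\mathfrak g_{\mathsf{As},\mathsf{dgraphs}},\mathrm{ad}_{a_1+a_2})$; that is, $b$ has total degree one, $[a_1+a_2,b]=0$, and there is no $x$ of total degree zero with $[a_1+a_2,x]=b$. -/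

import Mathlib

namespace DirGraphs

/-- Vertices of a graph with `n` external vertices and `m` internal vertices. -/
abbrev Vert (n m : ℕ) : Type := Fin n ⊕ Fin m

/-- A directed graph with linearly ordered edges: the list of its `e` edges (source, target),
in the given order. -/
abbrev Edges (n m e : ℕ) : Type := Fin e → Vert n m × Vert n m

section graphs

variable {n m e : ℕ}

/-- Number of edges ending at `v`. -/
def inDeg (E : Edges n m e) (v : Vert n m) : ℕ :=
  (Finset.univ.filter fun a => (E a).2 = v).card

/-- Number of edges starting at `v`. -/
def outDeg (E : Edges n m e) (v : Vert n m) : ℕ :=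
  (Finset.univ.filter fun a => (E a).1 = v).card

/-- `v` and `w` are joined by an edge, in some direction. -/
def Joined (E : Edges n m e) (v w : Vert n m) : Prop :=
  ∃ a, E a = (v, w) ∨ E a = (w, v)

/-- Every internal vertex can be connected by an (undirected) path with an external vertex. -/
def ConnectedToExternal (E : Edges n m e) : Prop :=
  ∀ i : Fin m, ∃ k : Fin n, Relation.ReflTransGen (Joined E) (Sum.inr i) (Sum.inl k)

/-- Admissible directed graphs. Double edges are edges with the same source and the same target;
two edges of opposite directions between the same vertices are allowed. The two degree conditions
include that internal vertices are at most trivalent. -/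
structure Admissible (E : Edges n m e) : Prop where
  noDouble : Function.Injective E
  noLoop : ∀ a, (E a).1 ≠ (E a).2
  connected : ConnectedToExternal E
  inDeg_le : ∀ i : Fin m, inDeg E (Sum.inr i) ≤ 1
  outDeg_le : ∀ i : Fin m, outDeg E (Sum.inr i) ≤ 2

/-- As `Admissible`, except that the internal vertex `v` may have three outgoing edges. -/
structure AdmissibleUpTo (E : Edges n m e) (v : Fin m) : Prop where
  noDouble : Function.Injective E
  noLoop : ∀ a, (E a).1 ≠ (E a).2
  connected : ConnectedToExternal E
  inDeg_le : ∀ i : Fin m, inDeg E (Sum.inr i) ≤ 1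
  outDeg_le : ∀ i : Fin m, i ≠ v → outDeg E (Sum.inr i) ≤ 2
  outDeg_le_three : outDeg E (Sum.inr v) ≤ 3

/-- The image of a graph under a map of vertices. -/
def mapV {n' m' : ℕ} (f : Vert n m → Vert n' m') (E : Edges n m e) : Edges n' m' e :=
  fun a => Prod.map f f (E a)

/-- All ways of reconnecting the edges of `E` along a map `f` which contracts groups of vertices:
all lists of edges `F` which become `E` after the contraction `f`. -/
def lifts {n' m' : ℕ} (f : Vert n' m' → Vert n m) (E : Edges n m e) : Finset (Edges n' m' e) :=
  Finset.univ.filter fun F => mapV f F = E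

/-- The contraction of the last internal vertex into the internal vertex `v`. -/
def merge (v : Fin m) : Vert n (m + 1) → Vert n m :=
  Sum.map id (Fin.lastCases v id)

/-- Append to `E`, as the last edge, an edge from the internal vertex `v` to the last internal
vertex. -/
def addEdge (v : Fin m) (E : Edges n (m + 1) e) : Edges n (m + 1) (e + 1) :=
  Fin.snoc (α := fun _ => Vert n (m + 1) × Vert n (m + 1)) E
    (Sum.inr v.castSucc, Sum.inr (Fin.last m))

end graphs

/-- Admissible directed graphs with `n` external vertices. -/
structure AdmGraph (n : ℕ) where
  m : ℕ
  e : ℕ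
  edge : Edges n m e
  adm : Admissible edge

section space

variable (K : Type*) [Field K]

open Classical in
/-- The generator given by a graph; graphs that are not admissible are discarded. -/
noncomputable def gen {n m e : ℕ} (E : Edges n m e) : AdmGraph n →₀ K :=
  if h : Admissible E then Finsupp.single ⟨m, e, E, h⟩ 1 else 0

/-- The relations: internal vertices are unlabeled; a permutation of the edges acts by its sign;
and the generalized IHX relations, in which an internal vertex `v` is replaced by two vertices
(`v` and a new, last one) connected by a directed edge (placed last), summing over all ways of
reconnecting the edges previously adjacent to `v` and keeping the admissible graphs. Here `v` is
either a vertex of an admissible graph or has at most one incoming and three outgoing edges. -/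
inductive IsRelation (n : ℕ) : (AdmGraph n →₀ K) → Prop
  | relabel {m e : ℕ} (E : Edges n m e) (hE : Admissible E) (τ : Equiv.Perm (Fin m)) :
      IsRelation n (gen K (mapV (Sum.map id τ) E) - gen K E)
  | order {m e : ℕ} (E : Edges n m e) (hE : Admissible E) (σ : Equiv.Perm (Fin e)) :
      IsRelation n (gen K (E ∘ σ) - (Equiv.Perm.sign σ : ℤ) • gen K E)
  | ihx {m e : ℕ} (E : Edges n m e) (v : Fin m) (hE : AdmissibleUpTo E v) :
      IsRelation n (∑ F ∈ lifts (merge v) E, gen K (addEdge v F))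

/-- The subspace spanned by the relations. -/
noncomputable def relations (n : ℕ) : Submodule K (AdmGraph n →₀ K) :=
  Submodule.span K {x | IsRelation K n x}

/-- The space `dgraphs(n)`. -/
def DGraphs (n : ℕ) : Type _ := (AdmGraph n →₀ K) ⧸ relations K n

noncomputable instance (n : ℕ) : AddCommGroup (DGraphs K n) :=
  inferInstanceAs (AddCommGroup ((AdmGraph n →₀ K) ⧸ relations K n))

noncomputable instance (n : ℕ) : Module K (DGraphs K n) :=
  inferInstanceAs (Module K ((AdmGraph n →₀ K) ⧸ relations K n))

/-- The projection to the quotient. -/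
noncomputable def proj (n : ℕ) : (AdmGraph n →₀ K) →ₗ[K] DGraphs K n := (relations K n).mkQ

/-- The class of a graph in `dgraphs(n)` (zero if the graph is not admissible). -/
noncomputable def cls {n m e : ℕ} (E : Edges n m e) : DGraphs K n :=
  proj K n (gen K E)

/-- The subspace of `dgraphs(n)` of elements of degree `d`: it is spanned by the graphs with
`2 #(internal vertices) - #(edges) = d`. -/
noncomputable def degreePart (n : ℕ) (d : ℤ) : Submodule K (DGraphs K n) :=
  Submodule.span K {x | ∃ G : AdmGraph n, 2 * (G.m : ℤ) - G.e = d ∧ x = cls K G.edge}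

end space

section insertion

variable {r s t : ℕ}

/-- Vertices of the graph obtained by inserting a graph with `s + 1` external and `m'` internal
vertices into the external vertex `j` of a graph with `r + 1` external and `m` internal vertices:
this map contracts the inserted vertices to `j`. -/
def collapse (h : r + s = t) (j : Fin (r + 1)) (m m' : ℕ) :
    Vert (t + 1) (m + m') → Vert (r + 1) m :=
  Sum.elim
    (fun k => Sum.inl
      (if hk : k.val < j.val then ⟨k.val, by omega⟩
        else if k.val ≤ j.val + s then j else ⟨k.val - s, by omega⟩))
    (Fin.addCases (fun i => Sum.inr i) fun _ => Sum.inl j)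

/-- The position of the inserted vertices. -/
def embed (h : r + s = t) (j : Fin (r + 1)) (m m' : ℕ) :
    Vert (s + 1) m' → Vert (t + 1) (m + m') :=
  Sum.map (fun k => ⟨j.val + k.val, by omega⟩) (Fin.natAdd m)

variable (K : Type*) [Field K]

/-- Insertion of `E'` into the external vertex `j` of `E`: sum over all ways of reconnecting the
edges previously adjacent to `j` to vertices of `E'`, the edges of `E` coming before
those of `E'`. -/
noncomputable def insertSum (h : r + s = t) (j : Fin (r + 1)) {m e m' e' : ℕ}
    (E : Edges (r + 1) m e) (E' : Edges (s + 1) m' e') : DGraphs K (t + 1) :=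
  ∑ F ∈ lifts (collapse h j m m') E, cls K (Fin.append F (mapV (embed h j m m') E'))

end insertion

section lemmas

variable {n m e n' m' n'' m'' : ℕ}

theorem mem_lifts {f : Vert n' m' → Vert n m} {E : Edges n m e} {F : Edges n' m' e} :
    F ∈ lifts f E ↔ mapV f F = E := by
  simp [lifts]

theorem mapV_mapV (g : Vert n m → Vert n' m') (f : Vert n' m' → Vert n'' m'') (E : Edges n m e) :
    mapV f (mapV g E) = mapV (f ∘ g) E := rfl

theorem mapV_injective {f : Vert n m → Vert n' m'} (hf : Function.Injective f) :
    Function.Injective (mapV f : Edges n m e → Edges n' m' e) := by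
  intro E F h
  funext a
  exact (hf.prodMap hf) (congrFun h a)

theorem mapV_append {e' : ℕ} (f : Vert n m → Vert n' m') (E : Edges n m e) (F : Edges n m e') :
    mapV f (Fin.append E F) = Fin.append (mapV f E) (mapV f F) := by
  funext a
  refine Fin.addCases (fun i => ?_) (fun i => ?_) a <;> simp [mapV]

theorem mapV_addEdge_of (v : Fin m) (w : Fin m') (f : Vert n (m + 1) → Vert n' (m' + 1))
    (h1 : f (Sum.inr v.castSucc) = Sum.inr w.castSucc)
    (h2 : f (Sum.inr (Fin.last m)) = Sum.inr (Fin.last m')) (E : Edges n (m + 1) e) :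
    mapV f (addEdge v E) = addEdge w (mapV f E) := by
  funext a
  refine Fin.lastCases ?_ (fun i => ?_) a
  · simp [mapV, addEdge, h1, h2]
  · simp [mapV, addEdge]

theorem sum_lifts_comp {M : Type*} [AddCommMonoid M] (f : Vert n' m' → Vert n m)
    (g : Vert n'' m'' → Vert n' m') (E : Edges n m e) (φ : Edges n'' m'' e → M) :
    ∑ H ∈ lifts (f ∘ g) E, φ H = ∑ F ∈ lifts f E, ∑ H ∈ lifts g F, φ H := by
  rw [← Finset.sum_fiberwise_of_maps_to (s := lifts (f ∘ g) E) (t := lifts f E)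
    (g := fun H => mapV g H)]
  · refine Finset.sum_congr rfl fun F hF => Finset.sum_congr ?_ fun _ _ => rfl
    rw [mem_lifts] at hF
    ext H
    simp only [Finset.mem_filter, mem_lifts]
    constructor
    · exact fun h => h.2
    · intro h
      refine ⟨?_, h⟩
      rw [← mapV_mapV, h, hF]
  · intro H hH
    rw [mem_lifts] at hH ⊢
    exact hH

theorem sum_lifts_append {M : Type*} [AddCommMonoid M] {e' : ℕ} (f : Vert n' m' → Vert n m)
    (A : Edges n m e) (B : Edges n m e') (φ : Edges n' m' (e + e') → M) :
    ∑ H ∈ lifts f (Fin.append A B), φ H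
      = ∑ F ∈ lifts f A, ∑ G ∈ lifts f B, φ (Fin.append F G) := by
  rw [← Finset.sum_product']
  symm
  refine Finset.sum_bij (fun p _ => Fin.append p.1 p.2) ?_ ?_ ?_ ?_
  · rintro ⟨F, G⟩ h
    simp only [Finset.mem_product, mem_lifts] at h
    rw [mem_lifts, mapV_append, h.1, h.2]
  · rintro ⟨F, G⟩ _ ⟨F', G'⟩ _ h
    exact (Fin.appendEquiv e e').injective h
  · intro H hH
    obtain ⟨⟨F, G⟩, rfl⟩ := (Fin.appendEquiv e e').surjective H
    refine ⟨(F, G), ?_, rfl⟩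
    rw [mem_lifts] at hH
    have h2 : Fin.append (mapV f F) (mapV f G) = Fin.append A B := by
      rw [← mapV_append]; exact hH
    have h3 := (Fin.appendEquiv e e').injective
      (a₁ := (mapV f F, mapV f G)) (a₂ := (A, B)) h2
    simp only [Prod.mk.injEq] at h3
    simp [mem_lifts, h3.1, h3.2]
  · intros; rfl

theorem sum_lifts_addEdge {M : Type*} [AddCommMonoid M] (f : Vert n' m' → Vert n m)
    (E : Edges n m e) (x y : Vert n m) (x' y' : Vert n' m')
    (hx : ∀ z, f z = x ↔ z = x') (hy : ∀ z, f z = y ↔ z = y') (φ : Edges n' m' (e + 1) → M) :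
    ∑ H ∈ lifts f (Fin.snoc (α := fun _ => Vert n m × Vert n m) E (x, y)), φ H
      = ∑ F ∈ lifts f E, φ (Fin.snoc (α := fun _ => Vert n' m' × Vert n' m') F (x', y')) := by
  symm
  refine Finset.sum_bij (fun F _ => Fin.snoc (α := fun _ => Vert n' m' × Vert n' m') F (x', y'))
    ?_ ?_ ?_ ?_
  · intro F hF
    rw [mem_lifts] at hF ⊢
    funext a
    refine Fin.lastCases ?_ (fun i => ?_) a
    · simp [mapV, (hx x').2 rfl, (hy y').2 rfl]
    · have := congrFun hF i
      simpa [mapV] using this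
  · intro F _ F' _ h
    exact (Fin.snoc_inj.1 h).1
  · intro H hH
    rw [mem_lifts] at hH
    refine ⟨Fin.init H, ?_, ?_⟩
    · rw [mem_lifts]
      funext i
      have := congrFun hH i.castSucc
      simpa [mapV, Fin.init] using this
    · have h1 := congrFun hH (Fin.last e)
      simp only [mapV, Fin.snoc_last, Prod.ext_iff, Prod.map_fst, Prod.map_snd] at h1
      have : (x', y') = H (Fin.last e) :=
        Prod.ext ((hx _).1 h1.1).symm ((hy _).1 h1.2).symm
      rw [this, Fin.snoc_init_self]
  · intros; rfl

theorem sum_lifts_square {M : Type*} [AddCommMonoid M] {n₁ m₁ n₂ m₂ : ℕ}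
    (f : Vert n' m' → Vert n m) (i : Vert n₁ m₁ → Vert n m) (i' : Vert n₂ m₂ → Vert n' m')
    (g : Vert n₂ m₂ → Vert n₁ m₁) (hi' : Function.Injective i') (hi : Function.Injective i)
    (hc : f ∘ i' = i ∘ g) (hp : ∀ w u, f w = i u → ∃ w', i' w' = w)
    (E : Edges n₁ m₁ e) (φ : Edges n' m' e → M) :
    ∑ H ∈ lifts f (mapV i E), φ H = ∑ F ∈ lifts g E, φ (mapV i' F) := by
  symm
  refine Finset.sum_bij (fun F _ => mapV i' F) ?_ ?_ ?_ ?_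
  · intro F hF
    rw [mem_lifts] at hF ⊢
    rw [mapV_mapV, hc, ← mapV_mapV, hF]
  · intro F _ F' _ h
    exact mapV_injective hi' h
  · intro H hH
    rw [mem_lifts] at hH
    have h1 : ∀ a, ∃ p : Vert n₂ m₂ × Vert n₂ m₂, Prod.map i' i' p = H a := by
      intro a
      have ha := congrFun hH a
      simp only [mapV, Prod.ext_iff, Prod.map_fst, Prod.map_snd] at ha
      obtain ⟨x, hx⟩ := hp _ _ ha.1
      obtain ⟨y, hy⟩ := hp _ _ ha.2
      exact ⟨(x, y), Prod.ext hx hy⟩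
    choose F hF using h1
    have hF' : mapV i' F = H := funext hF
    refine ⟨F, ?_, hF'⟩
    rw [mem_lifts]
    apply mapV_injective hi
    rw [mapV_mapV, ← hc, ← mapV_mapV, hF', hH]
  · intros; rfl

end lemmas

section admissibility

variable {n m e n' m' : ℕ}

theorem inDeg_mono {E : Edges n m e} {e' : ℕ} {H : Edges n' m' e'} (v : Vert n m) (w : Vert n' m')
    (κ : Fin e → Fin e') (hκ : Function.Injective κ)
    (h : ∀ a, (E a).2 = v → (H (κ a)).2 = w) : inDeg E v ≤ inDeg H w := by
  refine Finset.card_le_card_of_injOn κ ?_ (hκ.injOn)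
  intro a ha
  simp only [Finset.coe_filter, Finset.mem_univ, true_and, Set.mem_ofPred_eq] at ha ⊢
  exact h a ha

theorem outDeg_mono {E : Edges n m e} {e' : ℕ} {H : Edges n' m' e'} (v : Vert n m)
    (w : Vert n' m') (κ : Fin e → Fin e') (hκ : Function.Injective κ)
    (h : ∀ a, (E a).1 = v → (H (κ a)).1 = w) : outDeg E v ≤ outDeg H w := by
  refine Finset.card_le_card_of_injOn κ ?_ (hκ.injOn)
  intro a ha
  simp only [Finset.coe_filter, Finset.mem_univ, true_and, Set.mem_ofPred_eq] at ha ⊢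
  exact h a ha

/-- Connectedness passes to a contraction. -/
theorem ConnectedToExternal.contract {e' : ℕ} {E : Edges n m e} {H : Edges n' m' e'}
    (hH : ConnectedToExternal H) (f : Vert n' m' → Vert n m) (ι : Fin m → Fin m')
    (hι : ∀ i, f (Sum.inr (ι i)) = Sum.inr i) (hext : ∀ k, ∃ l, f (Sum.inl k) = Sum.inl l)
    (hedge : ∀ a, f (H a).1 = f (H a).2 ∨ ∃ b, E b = (f (H a).1, f (H a).2)) :
    ConnectedToExternal E := by
  intro i
  obtain ⟨k, hk⟩ := hH (ι i)
  obtain ⟨l, hl⟩ := hext k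
  refine ⟨l, ?_⟩
  have key : Relation.ReflTransGen (Joined E) (f (Sum.inr (ι i))) (f (Sum.inl k)) := by
    refine Relation.ReflTransGen.lift' f ?_ _ _ hk
    rintro x y ⟨a, ha | ha⟩
    · have h := hedge a
      rw [ha] at h
      rcases h with h | ⟨b, hb⟩
      · simp only at h
        rw [Function.onFun, h]
      · exact Relation.ReflTransGen.single ⟨b, Or.inl hb⟩
    · have h := hedge a
      rw [ha] at h
      rcases h with h | ⟨b, hb⟩
      · simp only at h
        rw [Function.onFun, h]
      · exact Relation.ReflTransGen.single ⟨b, Or.inr hb⟩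
  rwa [hι, hl] at key

@[simp] theorem merge_inl (v : Fin m) (k : Fin n) : merge v (Sum.inl k) = Sum.inl k := rfl

@[simp] theorem merge_castSucc (v i : Fin m) :
    merge (n := n) v (Sum.inr i.castSucc) = Sum.inr i := by
  simp [merge]

@[simp] theorem merge_last (v : Fin m) : merge (n := n) v (Sum.inr (Fin.last m)) = Sum.inr v := by
  simp [merge]

theorem merge_cases (v : Fin m) (x : Vert n (m + 1)) (y : Vert n m) (h : merge v x = y) :
    x = Sum.map id Fin.castSucc y ∨ (x = Sum.inr (Fin.last m) ∧ y = Sum.inr v) := by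
  subst h
  rcases x with k | i
  · left; simp
  · refine Fin.lastCases ?_ (fun i => ?_) i
    · right; simp
    · left; simp

/-- If a splitting of `A` at `v` is admissible, then `A` is admissible up to `v`. -/
theorem AdmissibleUpTo.of_split {A : Edges n m e} {v : Fin m} {H : Edges n (m + 1) e}
    (hA : Function.Injective A) (hA' : ∀ a, (A a).1 ≠ (A a).2) (hH : H ∈ lifts (merge v) A)
    (hadm : Admissible (addEdge v H)) : AdmissibleUpTo A v := by
  rw [mem_lifts] at hH
  have hHa : ∀ a, A a = (merge v (H a).1, merge v (H a).2) := fun a => (congrFun hH a).symm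
  refine ⟨hA, hA', ?_, ?_, ?_, ?_⟩
  · refine hadm.connected.contract (merge v) Fin.castSucc (by simp) (fun k => ⟨k, rfl⟩) ?_
    intro a
    refine Fin.lastCases ?_ (fun a => ?_) a
    · left; simp [addEdge]
    · right; exact ⟨a, by simp [addEdge, hHa]⟩
  · intro i
    by_cases hi : i = v
    · subst hi
      have h1 := hadm.inDeg_le i.castSucc
      have h2 := hadm.inDeg_le (Fin.last m)
      have h4 : ∀ a, (H a).2 ≠ Sum.inr (Fin.last m) := by
        intro a ha
        rw [inDeg, Finset.card_le_one] at h2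
        have := h2 a.castSucc (Finset.mem_filter.2 ⟨Finset.mem_univ _, by simp [addEdge, ha]⟩)
          (Fin.last e) (Finset.mem_filter.2 ⟨Finset.mem_univ _, by simp [addEdge]⟩)
        exact absurd this (Fin.castSucc_lt_last a).ne
      refine le_trans (inDeg_mono _ (Sum.inr i.castSucc) Fin.castSucc
        (Fin.castSucc_injective e) ?_) h1
      intro a ha
      rw [hHa] at ha
      rcases merge_cases _ _ _ ha with h | h
      · simpa [addEdge] using h
      · exact absurd h.1 (h4 a)
    · refine le_trans (inDeg_mono _ (Sum.inr i.castSucc) Fin.castSucc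
        (Fin.castSucc_injective e) ?_) (hadm.inDeg_le i.castSucc)
      intro a ha
      rw [hHa] at ha
      rcases merge_cases _ _ _ ha with h | h
      · simpa [addEdge] using h
      · exact absurd (Sum.inr_injective h.2) hi
  · intro i hi
    refine le_trans (outDeg_mono _ (Sum.inr i.castSucc) Fin.castSucc
        (Fin.castSucc_injective e) ?_) (hadm.outDeg_le i.castSucc)
    intro a ha
    rw [hHa] at ha
    rcases merge_cases _ _ _ ha with h | h
    · simpa [addEdge] using h
    · exact absurd (Sum.inr_injective h.2) hi
  · have h1 := hadm.outDeg_le v.castSucc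
    have h2 := hadm.outDeg_le (Fin.last m)
    simp only [outDeg] at h1 h2 ⊢
    rw [Finset.card_filter, Fin.sum_univ_castSucc] at h1 h2
    simp only [addEdge, Fin.snoc_castSucc, Fin.snoc_last] at h1 h2
    rw [← Finset.card_filter] at h1 h2
    have h3 : (Finset.univ.filter fun a => (A a).1 = Sum.inr v)
        ⊆ (Finset.univ.filter fun a => (H a).1 = Sum.inr v.castSucc)
          ∪ (Finset.univ.filter fun a => (H a).1 = Sum.inr (Fin.last m)) := by
      intro a ha
      simp only [Finset.mem_filter, Finset.mem_univ, true_and, Finset.mem_union] at ha ⊢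
      rw [hHa] at ha
      rcases merge_cases _ _ _ ha with h | h
      · left; simpa using h
      · exact Or.inr h.1
    have h4 := (Finset.card_le_card h3).trans (Finset.card_union_le _ _)
    simp only [if_true] at h1
    omega

theorem addEdge_noLoop {A : Edges n m e} {v : Fin m} {H : Edges n (m + 1) e}
    (hA' : ∀ a, (A a).1 ≠ (A a).2) (hH : H ∈ lifts (merge v) A) (a : Fin (e + 1)) :
    (addEdge v H a).1 ≠ (addEdge v H a).2 := by
  rw [mem_lifts] at hH
  refine Fin.lastCases ?_ (fun a => ?_) a
  · simp [addEdge, (Fin.castSucc_lt_last v).ne]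
  · intro h
    apply hA' a
    rw [← hH]
    simp only [addEdge, Fin.snoc_castSucc] at h
    simp [mapV, h]

theorem addEdge_noDouble {A : Edges n m e} {v : Fin m} {H : Edges n (m + 1) e}
    (hA : Function.Injective A)
    (hA' : ∀ a, (A a).1 ≠ (A a).2) (hH : H ∈ lifts (merge v) A) :
    Function.Injective (addEdge v H) := by
  rw [mem_lifts] at hH
  rw [addEdge, Fin.snoc_injective_iff]
  constructor
  · intro a b hab
    apply hA
    rw [← hH, mapV, mapV, hab]
  · rintro ⟨a, ha⟩
    apply hA' a
    rw [← hH]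
    simp [mapV, ha]

theorem addEdge_connected {A : Edges n m e} {v : Fin m} {H : Edges n (m + 1) e}
    (hA : ConnectedToExternal A) (hH : H ∈ lifts (merge v) A) :
    ConnectedToExternal (addEdge v H) := by
  rw [mem_lifts] at hH
  have hfib : ∀ x y : Vert n (m + 1), merge v x = merge v y →
      Relation.ReflTransGen (Joined (addEdge v H)) x y := by
    intro x y hxy
    have h0 : Joined (addEdge v H) (Sum.inr v.castSucc) (Sum.inr (Fin.last m)) :=
      ⟨Fin.last e, by simp [addEdge]⟩
    have h1 : Joined (addEdge v H) (Sum.inr (Fin.last m)) (Sum.inr v.castSucc) :=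
      ⟨Fin.last e, by simp [addEdge]⟩
    rcases merge_cases v x _ rfl with hx | ⟨hx, hx'⟩ <;>
    rcases merge_cases v y _ rfl with hy | ⟨hy, hy'⟩
    · rw [hx, hy, hxy]
    · rw [hx, hy, hxy, hy']
      exact Relation.ReflTransGen.single h0
    · rw [hx, hy, ← hxy, hx']
      exact Relation.ReflTransGen.single h1
    · rw [hx, hy]
  have hstep : ∀ x' y, Relation.ReflTransGen (Joined A) (merge v x') y →
      ∃ y', merge v y' = y ∧ Relation.ReflTransGen (Joined (addEdge v H)) x' y' := by
    intro x' y h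
    induction h with
    | refl => exact ⟨x', rfl, Relation.ReflTransGen.refl⟩
    | tail _ hbc ih =>
      obtain ⟨b', hb', hpath⟩ := ih
      obtain ⟨a, ha | ha⟩ := hbc
      · rw [← hH] at ha
        simp only [mapV, Prod.ext_iff, Prod.map_fst, Prod.map_snd] at ha
        refine ⟨(H a).2, ha.2, (hpath.trans (hfib _ _ (hb'.trans ha.1.symm))).tail ?_⟩
        exact ⟨a.castSucc, Or.inl (by simp [addEdge])⟩
      · rw [← hH] at ha
        simp only [mapV, Prod.ext_iff, Prod.map_fst, Prod.map_snd] at ha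
        refine ⟨(H a).1, ha.1, (hpath.trans (hfib _ _ (hb'.trans ha.2.symm))).tail ?_⟩
        exact ⟨a.castSucc, Or.inr (by simp [addEdge])⟩
  intro i
  obtain ⟨i', hi'⟩ : ∃ i' : Fin m, merge (n := n) v (Sum.inr i) = Sum.inr i' := by
    refine Fin.lastCases ?_ (fun i => ?_) i
    · exact ⟨v, by simp⟩
    · exact ⟨i, by simp⟩
  obtain ⟨k, hk⟩ := hA i'
  rw [← hi'] at hk
  obtain ⟨y', hy', hp⟩ := hstep _ _ hk
  refine ⟨k, ?_⟩
  rcases merge_cases v y' _ hy' with h | h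
  · rw [h] at hp
    exact hp
  · exact absurd h.2 (by simp)

end admissibility

section classes

variable {n m e : ℕ}

theorem Admissible.comp_perm {E : Edges n m e} (hE : Admissible E) (σ : Equiv.Perm (Fin e)) :
    Admissible (E ∘ σ) := by
  refine ⟨hE.noDouble.comp σ.injective, fun a => hE.noLoop _, ?_, ?_, ?_⟩
  · refine hE.connected.contract id id (fun _ => rfl) (fun k => ⟨k, rfl⟩) fun a => Or.inr ?_
    exact ⟨σ.symm a, by simp⟩
  · exact fun i => (inDeg_mono _ _ σ σ.injective fun a h => h).trans (hE.inDeg_le i)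
  · exact fun i => (outDeg_mono _ _ σ σ.injective fun a h => h).trans (hE.outDeg_le i)

theorem Admissible.relabel {E : Edges n m e} (hE : Admissible E) (τ : Equiv.Perm (Fin m)) :
    Admissible (mapV (Sum.map id τ) E) := by
  have hinj : Function.Injective (Sum.map id τ : Vert n m → Vert n m) :=
    Function.Injective.sumMap Function.injective_id τ.injective
  have hi : ∀ i, ∀ x : Vert n m, Sum.map id τ x = Sum.inr i → x = Sum.inr (τ.symm i) := by
    intro i x h
    apply hinj
    rw [h]
    simp
  refine ⟨?_, ?_, ?_, ?_, ?_⟩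
  · intro a b h
    exact hE.noDouble (hinj.prodMap hinj h)
  · intro a h
    exact hE.noLoop a (hinj h)
  · refine hE.connected.contract (Sum.map id τ) τ.symm (by simp) (fun k => ⟨k, rfl⟩)
      fun a => Or.inr ⟨a, rfl⟩
  · exact fun i => (inDeg_mono _ (Sum.inr (τ.symm i)) id Function.injective_id
      fun a h => hi i _ h).trans (hE.inDeg_le _)
  · exact fun i => (outDeg_mono _ (Sum.inr (τ.symm i)) id Function.injective_id
      fun a h => hi i _ h).trans (hE.outDeg_le _)

variable (K : Type*) [Field K]

theorem gen_of_not {E : Edges n m e} (h : ¬ Admissible E) : gen K E = 0 := dif_neg h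

theorem gen_of_adm (G : AdmGraph n) : gen K G.edge = Finsupp.single G 1 := dif_pos G.adm

theorem cls_of_not {E : Edges n m e} (h : ¬ Admissible E) : cls K E = 0 := by
  rw [cls, gen_of_not K h, map_zero]

theorem proj_of_isRelation {x : AdmGraph n →₀ K} (h : IsRelation K n x) :
    proj K n x = 0 :=
  (Submodule.Quotient.mk_eq_zero (relations K n)).2 (Submodule.subset_span h)

theorem cls_comp_perm (E : Edges n m e) (σ : Equiv.Perm (Fin e)) :
    cls K (E ∘ σ) = (Equiv.Perm.sign σ : ℤ) • cls K E := by
  by_cases hE : Admissible E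
  · have := proj_of_isRelation K (IsRelation.order E hE σ)
    rwa [map_sub, sub_eq_zero, map_zsmul] at this
  · rw [cls_of_not K hE, smul_zero, cls_of_not]
    intro h
    apply hE
    have h2 := h.comp_perm σ.symm
    rwa [Function.comp_assoc, Equiv.self_comp_symm, Function.comp_id] at h2

theorem cls_relabel (E : Edges n m e) (τ : Equiv.Perm (Fin m)) :
    cls K (mapV (Sum.map id τ) E) = cls K E := by
  by_cases hE : Admissible E
  · have := proj_of_isRelation K (IsRelation.relabel E hE τ)
    rwa [map_sub, sub_eq_zero] at this
  · rw [cls_of_not K hE, cls_of_not]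
    intro h
    apply hE
    have h2 := h.relabel τ.symm
    rw [mapV_mapV, Sum.map_comp_map, Equiv.symm_comp_self, Function.comp_id, Sum.map_id_id] at h2
    exact h2

theorem cls_equiv {m' e' : ℕ} (τ : Fin m ≃ Fin m') (σ : Fin e' ≃ Fin e) :
    ∃ ε : ℤ, ∀ E : Edges n m e, cls K (mapV (Sum.map id τ) E ∘ σ) = ε • cls K E := by
  obtain rfl : m = m' := by simpa using Fintype.card_congr τ
  obtain rfl : e' = e := by simpa using Fintype.card_congr σ
  exact ⟨Equiv.Perm.sign σ, fun E => by rw [cls_comp_perm, cls_relabel]⟩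

theorem sum_cls_addEdge {A : Edges n m e} (v : Fin m) (hA : Function.Injective A)
    (hA' : ∀ a, (A a).1 ≠ (A a).2) : ∑ H ∈ lifts (merge v) A, cls K (addEdge v H) = 0 := by
  by_cases h : AdmissibleUpTo A v
  · have := proj_of_isRelation K (IsRelation.ihx A v h)
    rwa [map_sum] at this
  · exact Finset.sum_eq_zero fun H hH => cls_of_not K fun hadm => h (.of_split hA hA' hH hadm)

end classes

section insertion_lemmas

variable {r s t : ℕ} (h : r + s = t) (j : Fin (r + 1)) {m e m' e' : ℕ}

@[simp] theorem collapse_castAdd (i : Fin m) :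
    collapse h j m m' (Sum.inr (Fin.castAdd m' i)) = Sum.inr i := by
  simp [collapse]

@[simp] theorem collapse_natAdd (i : Fin m') :
    collapse h j m m' (Sum.inr (Fin.natAdd m i)) = Sum.inl j := by
  simp [collapse]

theorem collapse_inl (k : Fin (t + 1)) : ∃ l, collapse h j m m' (Sum.inl k) = Sum.inl l :=
  ⟨_, rfl⟩

theorem collapse_embed (u : Vert (s + 1) m') :
    collapse h j m m' (embed h j m m' u) = Sum.inl j := by
  rcases u with k | i
  · have hk : k.val ≤ s := by omega
    simp [collapse, embed, hk]
  · simp [embed]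

theorem collapse_eq_inr {w : Vert (t + 1) (m + m')} {i : Fin m}
    (hw : collapse h j m m' w = Sum.inr i) : w = Sum.inr (Fin.castAdd m' i) := by
  rcases w with k | l
  · simp [collapse] at hw
  · revert hw
    refine Fin.addCases (fun l => ?_) (fun l => ?_) l
    · simp
    · simp

theorem collapse_eq_iff (w : Vert (t + 1) (m + m')) (i : Fin m) :
    collapse h j m m' w = Sum.inr i ↔ w = Sum.inr (Fin.castAdd m' i) :=
  ⟨collapse_eq_inr h j, fun hw => by rw [hw, collapse_castAdd]⟩

theorem collapse_eq_inl {w : Vert (t + 1) (m + m')}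
    (hw : collapse h j m m' w = Sum.inl j) : ∃ u, embed h j m m' u = w := by
  rcases w with k | l
  · simp only [collapse, Sum.elim_inl, Sum.inl.injEq] at hw
    have hj := congrArg Fin.val hw
    split_ifs at hj with h1 h2
    · simp only at hj
      omega
    · refine ⟨Sum.inl ⟨k.val - j.val, by omega⟩, ?_⟩
      simp only [embed, Sum.map_inl, Sum.inl.injEq, Fin.ext_iff]
      omega
    · simp only at hj
      omega
  · revert hw
    refine Fin.addCases (fun l => ?_) (fun l => ?_) l
    · simp
    · intro _
      exact ⟨Sum.inr l, rfl⟩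

theorem embed_injective : Function.Injective (embed h j m m') := by
  refine Function.Injective.sumMap (fun a b hab => ?_) (Fin.natAdd_injective m' m)
  simp only [Fin.ext_iff] at hab ⊢
  omega

variable {h j} in
theorem append_noLoop {E : Edges (r + 1) m e} {E' : Edges (s + 1) m' e'}
    (h1 : ∀ a, (E a).1 ≠ (E a).2) (h2 : ∀ a, (E' a).1 ≠ (E' a).2)
    {F : Edges (t + 1) (m + m') e} (hF : F ∈ lifts (collapse h j m m') E) (a : Fin (e + e')) :
    (Fin.append F (mapV (embed h j m m') E') a).1
      ≠ (Fin.append F (mapV (embed h j m m') E') a).2 := by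
  rw [mem_lifts] at hF
  refine Fin.addCases (fun a => ?_) (fun a => ?_) a
  · rw [Fin.append_left]
    intro hh
    apply h1 a
    rw [← hF]
    simp [mapV, hh]
  · rw [Fin.append_right]
    intro hh
    exact h2 a (embed_injective h j hh)

variable {h j} in
theorem append_noDouble {E : Edges (r + 1) m e} {E' : Edges (s + 1) m' e'}
    (h1 : ∀ a, (E a).1 ≠ (E a).2) (h3 : Function.Injective E) (h4 : Function.Injective E')
    {F : Edges (t + 1) (m + m') e} (hF : F ∈ lifts (collapse h j m m') E) :
    Function.Injective (Fin.append F (mapV (embed h j m m') E')) := by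
  rw [mem_lifts] at hF
  rw [Fin.append_injective_iff]
  refine ⟨?_, ?_, ?_⟩
  · intro a b hab
    apply h3
    rw [← hF, mapV, mapV, hab]
  · intro a b hab
    exact h4 (((embed_injective h j).prodMap (embed_injective h j)) hab)
  · intro a b hab
    apply h1 a
    rw [← hF]
    simp [mapV, hab, collapse_embed]

variable {h j} in
theorem Admissible.of_append_left {E : Edges (r + 1) m e} {E' : Edges (s + 1) m' e'}
    (h1 : ∀ a, (E a).1 ≠ (E a).2) (h3 : Function.Injective E)
    {F : Edges (t + 1) (m + m') e} (hF : F ∈ lifts (collapse h j m m') E)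
    (hadm : Admissible (Fin.append F (mapV (embed h j m m') E'))) : Admissible E := by
  rw [mem_lifts] at hF
  refine ⟨h3, h1, ?_, fun i => ?_, fun i => ?_⟩
  · refine hadm.connected.contract (collapse h j m m') (Fin.castAdd m')
      (collapse_castAdd h j) (collapse_inl h j) fun a => ?_
    refine Fin.addCases (fun a => ?_) (fun a => ?_) a
    · right
      exact ⟨a, by rw [← hF, Fin.append_left]; rfl⟩
    · left
      simp [mapV, collapse_embed]
  · refine (inDeg_mono _ (Sum.inr (Fin.castAdd m' i)) (Fin.castAdd e')
      (Fin.castAdd_injective e e') fun a ha => ?_).trans (hadm.inDeg_le _)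
    rw [Fin.append_left]
    apply collapse_eq_inr h j
    rw [← ha, ← hF]
    rfl
  · refine (outDeg_mono _ (Sum.inr (Fin.castAdd m' i)) (Fin.castAdd e')
      (Fin.castAdd_injective e e') fun a ha => ?_).trans (hadm.outDeg_le _)
    rw [Fin.append_left]
    apply collapse_eq_inr h j
    rw [← ha, ← hF]
    rfl

variable {h j} in
theorem Admissible.of_append_right {E' : Edges (s + 1) m' e'}
    (h1 : ∀ a, (E' a).1 ≠ (E' a).2) (h3 : Function.Injective E') (hc : ConnectedToExternal E')
    {F : Edges (t + 1) (m + m') e}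
    (hadm : Admissible (Fin.append F (mapV (embed h j m m') E'))) : Admissible E' := by
  refine ⟨h3, h1, hc, fun i => ?_, fun i => ?_⟩
  · refine (inDeg_mono _ (Sum.inr (Fin.natAdd m i)) (Fin.natAdd e)
      (Fin.natAdd_injective e' e) fun a ha => ?_).trans (hadm.inDeg_le _)
    rw [Fin.append_right]
    simp [mapV, ha, embed]
  · refine (outDeg_mono _ (Sum.inr (Fin.natAdd m i)) (Fin.natAdd e)
      (Fin.natAdd_injective e' e) fun a ha => ?_).trans (hadm.outDeg_le _)
    rw [Fin.append_right]
    simp [mapV, ha, embed]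

variable (K : Type*) [Field K]

theorem insertSum_order_right (E : Edges (r + 1) m e) (E' : Edges (s + 1) m' e')
    (σ : Equiv.Perm (Fin e')) :
    insertSum K h j E (E' ∘ σ) = (Equiv.Perm.sign σ : ℤ) • insertSum K h j E E' := by
  rw [insertSum, insertSum, Finset.smul_sum]
  refine Finset.sum_congr rfl fun F _ => ?_
  have := cls_comp_perm K (Fin.append F (mapV (embed h j m m') E'))
    (finSumFinEquiv.permCongr (Equiv.Perm.sumCongr (Equiv.refl _) σ))
  rw [Equiv.Perm.sign_permCongr, Equiv.Perm.sign_sumCongr, Equiv.Perm.sign_refl, one_mul] at this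
  rw [← this]
  congr 1
  funext a
  refine Fin.addCases (fun a => ?_) (fun a => ?_) a
  · simp [Equiv.permCongr_apply]
  · simp [Equiv.permCongr_apply, mapV]

theorem insertSum_order_left (E : Edges (r + 1) m e) (E' : Edges (s + 1) m' e')
    (σ : Equiv.Perm (Fin e)) :
    insertSum K h j (E ∘ σ) E' = (Equiv.Perm.sign σ : ℤ) • insertSum K h j E E' := by
  rw [insertSum, insertSum, Finset.smul_sum]
  symm
  refine Finset.sum_bij (fun F _ => F ∘ σ) ?_ ?_ ?_ ?_
  · intro F hF
    rw [mem_lifts] at hF ⊢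
    rw [← hF]
    rfl
  · intro F _ F' _ hh
    exact σ.surjective.injective_comp_right hh
  · intro H hH
    rw [mem_lifts] at hH
    refine ⟨H ∘ σ.symm, ?_, ?_⟩
    · rw [mem_lifts]
      have h2 : mapV (collapse h j m m') (H ∘ σ.symm) = (E ∘ σ) ∘ σ.symm := by
        rw [← hH]; rfl
      rw [h2, Function.comp_assoc, Equiv.self_comp_symm, Function.comp_id]
    · rw [Function.comp_assoc, Equiv.symm_comp_self, Function.comp_id]
  · intro F _
    have := cls_comp_perm K (Fin.append F (mapV (embed h j m m') E'))
      (finSumFinEquiv.permCongr (Equiv.Perm.sumCongr σ (Equiv.refl _)))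
    rw [Equiv.Perm.sign_permCongr, Equiv.Perm.sign_sumCongr, Equiv.Perm.sign_refl, mul_one] at this
    rw [← this]
    congr 1
    funext a
    refine Fin.addCases (fun a => ?_) (fun a => ?_) a
    · simp [Equiv.permCongr_apply]
    · simp [Equiv.permCongr_apply]

theorem sum_lifts_equiv {M : Type*} [AddCommMonoid M] {n n' k m₀ m₁ m₂ : ℕ}
    (f : Vert n' m₁ → Vert n m₀) (g : Vert n' m₂ → Vert n m₀) (ρ : Vert n' m₁ ≃ Vert n' m₂)
    (hρ : ∀ x, g (ρ x) = f x) (E : Edges n m₀ k) (φ : Edges n' m₂ k → M) :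
    ∑ F ∈ lifts f E, φ (mapV ρ F) = ∑ F ∈ lifts g E, φ F := by
  have hgf : g ∘ ρ = f := funext hρ
  refine Finset.sum_bij (fun F _ => mapV ρ F) ?_ ?_ ?_ ?_
  · intro F hF
    rw [mem_lifts] at hF ⊢
    rw [mapV_mapV, hgf, hF]
  · intro F _ F' _ hh
    exact mapV_injective ρ.injective hh
  · intro H hH
    rw [mem_lifts] at hH
    refine ⟨mapV ρ.symm H, ?_, ?_⟩
    · rw [mem_lifts, mapV_mapV, ← hgf, Function.comp_assoc, Equiv.self_comp_symm, Function.comp_id,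
        hH]
    · rw [mapV_mapV, Equiv.self_comp_symm]
      rfl
  · intros; rfl

theorem insertSum_relabel_right (E : Edges (r + 1) m e) (E' : Edges (s + 1) m' e')
    (τ : Equiv.Perm (Fin m')) :
    insertSum K h j E (mapV (Sum.map id τ) E') = insertSum K h j E E' := by
  rw [insertSum, insertSum]
  let τ' : Equiv.Perm (Fin (m + m')) :=
    finSumFinEquiv.permCongr (Equiv.Perm.sumCongr (Equiv.refl _) τ)
  rw [← sum_lifts_equiv (collapse h j m m') (collapse h j m m')
    (Equiv.sumCongr (Equiv.refl _) τ')]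
  · refine Finset.sum_congr rfl fun F _ => ?_
    rw [← cls_relabel K (Fin.append F _) τ', mapV_append]
    congr 2
    rw [mapV_mapV, mapV_mapV]
    congr 1
    funext u
    rcases u with k | i
    · simp [embed]
    · simp [embed, τ', Equiv.permCongr_apply]
  · intro x
    rcases x with k | i
    · rfl
    · refine Fin.addCases (fun i => ?_) (fun i => ?_) i
      · simp [τ', Equiv.permCongr_apply]
      · simp [τ', Equiv.permCongr_apply]

theorem insertSum_relabel_left (E : Edges (r + 1) m e) (E' : Edges (s + 1) m' e')
    (τ : Equiv.Perm (Fin m)) :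
    insertSum K h j (mapV (Sum.map id τ) E) E' = insertSum K h j E E' := by
  rw [insertSum, insertSum]
  let τ' : Equiv.Perm (Fin (m + m')) :=
    finSumFinEquiv.permCongr (Equiv.Perm.sumCongr τ (Equiv.refl _))
  have hτ : ∀ x, collapse h j m m' (Sum.map id τ' x) = Sum.map id τ (collapse h j m m' x) := by
    intro x
    rcases x with k | i
    · rfl
    · refine Fin.addCases (fun i => ?_) (fun i => ?_) i
      · simp [τ', Equiv.permCongr_apply]
      · simp [τ', Equiv.permCongr_apply]
  symm
  refine Finset.sum_bij (fun F _ => mapV (Sum.map id τ') F) ?_ ?_ ?_ ?_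
  · intro F hF
    rw [mem_lifts] at hF ⊢
    rw [mapV_mapV, ← hF, mapV_mapV]
    exact congrArg (fun f => mapV f F) (funext hτ)
  · intro F _ F' _ hh
    exact mapV_injective (Function.Injective.sumMap Function.injective_id τ'.injective) hh
  · intro H hH
    rw [mem_lifts] at hH
    have h0 : mapV (Sum.map id τ') (mapV (Sum.map id τ'.symm) H) = H := by
      rw [mapV_mapV, Sum.map_comp_map, Equiv.self_comp_symm, Function.comp_id, Sum.map_id_id]
      rfl
    refine ⟨mapV (Sum.map id τ'.symm) H, ?_, h0⟩
    rw [mem_lifts]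
    apply mapV_injective (Function.Injective.sumMap Function.injective_id τ.injective)
    rw [← hH]
    conv_rhs => rw [← h0]
    rw [mapV_mapV (collapse h j m m'), mapV_mapV (Sum.map id τ') (collapse h j m m')]
    exact congrArg (fun f => mapV f (mapV (Sum.map id τ'.symm) H)) (funext fun x => (hτ x).symm)
  · intro F _
    rw [← cls_relabel K _ τ', mapV_append]
    congr 2
    rw [mapV_mapV]
    congr 1
    funext u
    rcases u with k | i
    · simp [embed]
    · simp [embed, τ', Equiv.permCongr_apply]

theorem insertSum_ihx_right (E : Edges (r + 1) m e) (E' : Edges (s + 1) m' e')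
    (h1 : ∀ a, (E a).1 ≠ (E a).2) (h2 : Function.Injective E)
    (h3 : ∀ a, (E' a).1 ≠ (E' a).2) (h4 : Function.Injective E') (v : Fin m') :
    ∑ F ∈ lifts (merge v) E', insertSum K h j E (addEdge v F) = 0 := by
  let w : Fin (m + m') := Fin.natAdd m v
  have hcol : collapse h j m (m' + 1) = collapse h j m m' ∘ merge w := by
    funext x
    rcases x with k | i
    · rfl
    · refine Fin.addCases (fun i => ?_) (fun i => ?_) i
      · have : Sum.inr (Fin.castAdd (m' + 1) i)
          = (Sum.inr (Fin.castSucc (Fin.castAdd m' i)) : Vert (t + 1) (m + m' + 1)) := rfl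
        rw [Function.comp_apply, collapse_castAdd, this, merge_castSucc, collapse_castAdd]
      · rw [Function.comp_apply, collapse_natAdd]
        refine Fin.lastCases ?_ (fun i => ?_) i
        · have : Sum.inr (Fin.natAdd m (Fin.last m'))
            = (Sum.inr (Fin.last (m + m')) : Vert (t + 1) (m + m' + 1)) := rfl
          rw [this, merge_last, collapse_natAdd]
        · have : Sum.inr (Fin.natAdd m i.castSucc)
            = (Sum.inr (Fin.castSucc (Fin.natAdd m i)) : Vert (t + 1) (m + m' + 1)) := rfl
          rw [this, merge_castSucc, collapse_natAdd]
  have hsq : merge w ∘ embed h j m (m' + 1) = embed h j m m' ∘ merge v := by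
    funext u
    rcases u with k | i
    · rfl
    · refine Fin.lastCases ?_ (fun i => ?_) i
      · have : embed h j m (m' + 1) (Sum.inr (Fin.last m'))
            = (Sum.inr (Fin.last (m + m')) : Vert (t + 1) (m + m' + 1)) := rfl
        rw [Function.comp_apply, this, merge_last]
        simp [embed, w]
      · have : embed h j m (m' + 1) (Sum.inr i.castSucc)
            = (Sum.inr (Fin.castSucc (Fin.natAdd m i)) : Vert (t + 1) (m + m' + 1)) := rfl
        rw [Function.comp_apply, this, merge_castSucc]
        simp [embed]
  have hpull : ∀ (x : Vert (t + 1) (m + m' + 1)) u, merge w x = embed h j m m' u →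
      ∃ u', embed h j m (m' + 1) u' = x := by
    intro x u hx
    apply collapse_eq_inl h j
    have := congrFun hcol x
    rw [this, Function.comp_apply, hx, collapse_embed]
  have key : ∑ G ∈ lifts (collapse h j m m') E, ∑ H ∈ lifts (merge w)
      (Fin.append G (mapV (embed h j m m') E')), cls K (addEdge w H) = 0 :=
    Finset.sum_eq_zero fun G hG => sum_cls_addEdge K w (append_noDouble h1 h2 h4 hG)
      (append_noLoop h1 h3 hG)
  rw [← key]
  simp only [insertSum]
  rw [Finset.sum_comm]
  have hcol2 : ∀ φ : Edges (t + 1) (m + m' + 1) e → DGraphs K (t + 1),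
      ∑ y ∈ lifts (collapse h j m (m' + 1)) E, φ y
        = ∑ G ∈ lifts (collapse h j m m') E, ∑ H ∈ lifts (merge w) G, φ H := by
    intro φ
    rw [← sum_lifts_comp, ← hcol]
    rfl
  refine (hcol2 _).trans ?_
  refine Finset.sum_congr rfl fun G _ => ?_
  rw [sum_lifts_append]
  refine Finset.sum_congr rfl fun F _ => ?_
  rw [sum_lifts_square (merge w) (embed h j m m') (embed h j m (m' + 1)) (merge v)
    (embed_injective h j) (embed_injective h j) hsq hpull]
  refine Finset.sum_congr rfl fun F' _ => ?_
  congr 1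
  refine Eq.trans ?_ (Fin.append_snoc F (mapV (embed h j m (m' + 1)) F')
    (Sum.inr w.castSucc, Sum.inr (Fin.last (m + m'))))
  congr 1
  funext a
  refine Fin.lastCases ?_ (fun a => ?_) a
  · simp only [mapV, addEdge, Fin.snoc_last]
    rfl
  · simp [mapV, addEdge]

/-- Moving the second to last block: the new internal vertex and the new edge become last. -/
def lastEquiv (a b : ℕ) : Fin (a + 1 + b) ≃ Fin (a + b + 1) :=
  finSumFinEquiv.symm.trans <| (Equiv.sumCongr finSumFinEquiv.symm (Equiv.refl _)).trans <|
    (Equiv.sumAssoc _ _ _).trans <| (Equiv.sumCongr (Equiv.refl _) (Equiv.sumComm _ _)).trans <|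
      (Equiv.sumAssoc _ _ _).symm.trans <| (Equiv.sumCongr finSumFinEquiv (Equiv.refl _)).trans
        finSumFinEquiv

theorem lastEquiv_left (a b : ℕ) (i : Fin a) :
    lastEquiv a b (Fin.castAdd b i.castSucc) = (Fin.castAdd b i).castSucc := by
  have : i.castSucc = Fin.castAdd 1 i := rfl
  simp only [lastEquiv, Equiv.trans_apply, finSumFinEquiv_symm_apply_castAdd, this]
  simp [finSumFinEquiv_symm_apply_castAdd]
  rfl

theorem lastEquiv_mid (a b : ℕ) :
    lastEquiv a b (Fin.castAdd b (Fin.last a)) = Fin.last (a + b) := by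
  have : Fin.last a = Fin.natAdd a (0 : Fin 1) := rfl
  simp only [lastEquiv, Equiv.trans_apply, finSumFinEquiv_symm_apply_castAdd, this]
  simp only [Equiv.sumCongr_apply, Sum.map_inl, finSumFinEquiv_symm_apply_natAdd]
  rfl

theorem lastEquiv_right (a b : ℕ) (i : Fin b) :
    lastEquiv a b (Fin.natAdd (a + 1) i) = (Fin.natAdd a i).castSucc := by
  simp only [lastEquiv, Equiv.trans_apply, finSumFinEquiv_symm_apply_natAdd]
  rfl

theorem insertSum_ihx_left (E : Edges (r + 1) m e) (E' : Edges (s + 1) m' e')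
    (h1 : ∀ a, (E a).1 ≠ (E a).2) (h2 : Function.Injective E)
    (h3 : ∀ a, (E' a).1 ≠ (E' a).2) (h4 : Function.Injective E') (v : Fin m) :
    ∑ F ∈ lifts (merge v) E, insertSum K h j (addEdge v F) E' = 0 := by
  let w : Fin (m + m') := Fin.castAdd m' v
  let τ := lastEquiv m m'
  let ρ : Vert (t + 1) (m + 1 + m') ≃ Vert (t + 1) (m + m' + 1) :=
    Equiv.sumCongr (Equiv.refl _) τ
  have hρemb : ∀ u, ρ (embed h j (m + 1) m' u)
      = Sum.map id Fin.castSucc (embed h j m m' u) := by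
    intro u
    rcases u with k | i
    · rfl
    · simp [ρ, embed, τ, lastEquiv_right]
  have hcol : ∀ x, (collapse h j m m' ∘ merge w) (ρ x)
      = (merge v ∘ collapse h j (m + 1) m') x := by
    intro x
    rcases x with k | i
    · simp only [Function.comp_apply]
      have : ρ (Sum.inl k) = Sum.inl k := rfl
      rw [this, merge_inl]
      rfl
    · refine Fin.addCases (fun i => ?_) (fun i => ?_) i
      · refine Fin.lastCases ?_ (fun i => ?_) i
        · simp [ρ, τ, lastEquiv_mid, w]
        · simp [ρ, τ, lastEquiv_left]
      · simp [ρ, τ, lastEquiv_right, -Fin.castSucc_natAdd]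
  obtain ⟨ε, hε⟩ := cls_equiv (n := t + 1) K τ.symm (lastEquiv e e')
  have key : ∑ G ∈ lifts (collapse h j m m') E, ∑ H ∈ lifts (merge w)
      (Fin.append G (mapV (embed h j m m') E')), cls K (addEdge w H) = 0 :=
    Finset.sum_eq_zero fun G hG => sum_cls_addEdge K w (append_noDouble h1 h2 h4 hG)
      (append_noLoop h1 h3 hG)
  have key2 : ∑ G ∈ lifts (collapse h j m m') E, ∑ H ∈ lifts (merge w) G,
      cls K (addEdge w (Fin.append H
        (mapV (Sum.map id Fin.castSucc) (mapV (embed h j m m') E')))) = 0 := by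
    rw [← key]
    refine Finset.sum_congr rfl fun G _ => ?_
    rw [sum_lifts_append]
    refine Finset.sum_congr rfl fun F _ => ?_
    symm
    rw [sum_lifts_square (merge w) (embed h j m m')
      (Sum.map id Fin.castSucc ∘ embed h j m m') id]
    · rw [Finset.sum_eq_single E']
      · rfl
      · intro F hF hne
        exact absurd ((mem_lifts.1 hF)) hne
      · intro hE
        exact absurd (mem_lifts.2 rfl) hE
    · exact (Function.Injective.sumMap Function.injective_id (Fin.castSucc_injective _)).comp
        (embed_injective h j)
    · exact embed_injective h j
    · funext u
      rcases u with k | i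
      · rfl
      · exact merge_castSucc w (Fin.natAdd m i)
    · intro x u hx
      refine ⟨u, ?_⟩
      rcases merge_cases _ _ _ hx with hx | hx
      · rw [hx]; rfl
      · exfalso
        rcases u with k | i
        · simp [embed] at hx
        · have := congrArg (collapse h j m m') hx.2
          rw [collapse_embed] at this
          simp [w] at this
  rw [← sum_lifts_comp, ← sum_lifts_equiv _ _ ρ hcol, sum_lifts_comp] at key2
  have key3 := congrArg (fun x => ε • x) key2
  simp only [smul_zero, Finset.smul_sum] at key3
  rw [← key3]
  refine Finset.sum_congr rfl fun F _ => ?_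
  rw [insertSum, addEdge, sum_lifts_addEdge (collapse h j (m + 1) m') F _ _ _ _
    (fun z => collapse_eq_iff h j z _) (fun z => collapse_eq_iff h j z _)]
  refine Finset.sum_congr rfl fun H _ => ?_
  rw [← hε]
  congr 1
  funext a
  have hback : ∀ x, Sum.map id τ.symm (ρ x) = x := by
    intro x
    rcases x with k | i
    · rfl
    · simp [ρ]
  refine Fin.addCases (fun a => ?_) (fun a => ?_) a
  · refine Fin.lastCases ?_ (fun a => ?_) a
    · rw [Fin.append_left, Fin.snoc_last, Function.comp_apply, lastEquiv_mid, mapV, addEdge,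
        Fin.snoc_last]
      have e1 : Sum.map id τ.symm (Sum.inr w.castSucc : Vert (t + 1) (m + m' + 1))
          = Sum.inr (Fin.castAdd m' v.castSucc) := by
        rw [← hback (Sum.inr (Fin.castAdd m' v.castSucc))]
        simp [ρ, τ, lastEquiv_left, w]
      have e2 : Sum.map id τ.symm (Sum.inr (Fin.last (m + m')) : Vert (t + 1) (m + m' + 1))
          = Sum.inr (Fin.castAdd m' (Fin.last m)) := by
        rw [← hback (Sum.inr (Fin.castAdd m' (Fin.last m)))]
        simp [ρ, τ, lastEquiv_mid]
      rw [Prod.map_apply, e1, e2]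
    · rw [Fin.append_left, Fin.snoc_castSucc, Function.comp_apply, lastEquiv_left, mapV, addEdge,
        Fin.snoc_castSucc, Fin.append_left, mapV, Prod.map_map]
      have : (Sum.map id τ.symm ∘ ρ) = id := funext hback
      rw [this, Prod.map_id, id]
  · rw [Fin.append_right, Function.comp_apply, lastEquiv_right, mapV, mapV, addEdge,
      Fin.snoc_castSucc, Fin.append_right, mapV, mapV]
    simp only [Prod.map_map]
    have : (Sum.map id τ.symm ∘ Sum.map id Fin.castSucc ∘ embed h j m m') = embed h j (m + 1) m' := by
      funext u
      rw [Function.comp_apply, Function.comp_apply, ← hρemb, hback]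
    rw [this]

theorem insertSum_eq_zero_left {E : Edges (r + 1) m e} (E' : Edges (s + 1) m' e')
    (h1 : ∀ a, (E a).1 ≠ (E a).2) (h2 : Function.Injective E) (hE : ¬ Admissible E) :
    insertSum K h j E E' = 0 :=
  Finset.sum_eq_zero fun _ hF => cls_of_not K fun hadm => hE (.of_append_left h1 h2 hF hadm)

theorem insertSum_eq_zero_right (E : Edges (r + 1) m e) {E' : Edges (s + 1) m' e'}
    (h1 : ∀ a, (E' a).1 ≠ (E' a).2) (h2 : Function.Injective E') (hc : ConnectedToExternal E')
    (hE : ¬ Admissible E') : insertSum K h j E E' = 0 :=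
  Finset.sum_eq_zero fun _ _ => cls_of_not K fun hadm => hE (.of_append_right h1 h2 hc hadm)

end insertion_lemmas

section operad

variable (K : Type*) [Field K] {r s t : ℕ} (h : r + s = t) (j : Fin (r + 1))

/-- Insertion into the graph `G`, as a linear map on `dgraphs(s + 1)`. -/
noncomputable def insertInto (G : AdmGraph (r + 1)) :
    DGraphs K (s + 1) →ₗ[K] DGraphs K (t + 1) :=
  (relations K (s + 1)).liftQ
    (Finsupp.linearCombination K fun G' : AdmGraph (s + 1) => insertSum K h j G.edge G'.edge)
    (by
      have hgen : ∀ {m e : ℕ} (E' : Edges (s + 1) m e), (∀ a, (E' a).1 ≠ (E' a).2) →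
          Function.Injective E' → ConnectedToExternal E' →
          Finsupp.linearCombination K (fun G' : AdmGraph (s + 1) => insertSum K h j G.edge G'.edge)
            (gen K E') = insertSum K h j G.edge E' := by
        intro m e E' h1 h2 h3
        by_cases hE : Admissible E'
        · rw [gen, dif_pos hE, Finsupp.linearCombination_single, one_smul]
        · rw [gen_of_not K hE, map_zero, insertSum_eq_zero_right h j K _ h1 h2 h3 hE]
      have hgen' : ∀ {m e : ℕ} (E' : Edges (s + 1) m e), Admissible E' →
          Finsupp.linearCombination K (fun G' : AdmGraph (s + 1) => insertSum K h j G.edge G'.edge)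
            (gen K E') = insertSum K h j G.edge E' :=
        fun E' hE => hgen E' hE.noLoop hE.noDouble hE.connected
      rw [relations, Submodule.span_le]
      rintro x hx
      rw [SetLike.mem_coe, LinearMap.mem_ker]
      cases hx with
      | relabel E hE τ =>
        rw [map_sub, hgen' _ hE, hgen' _ (hE.relabel τ), insertSum_relabel_right, sub_self]
      | order E hE σ =>
        rw [map_sub, map_zsmul, hgen' _ hE, hgen' _ (hE.comp_perm σ), insertSum_order_right,
          sub_self]
      | ihx E v hE =>
        rw [map_sum, ← insertSum_ihx_right h j K G.edge E G.adm.noLoop G.adm.noDouble hE.noLoop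
          hE.noDouble v]
        exact Finset.sum_congr rfl fun F hF => hgen _ (addEdge_noLoop hE.noLoop hF)
          (addEdge_noDouble hE.noDouble hE.noLoop hF) (addEdge_connected hE.connected hF))

theorem insertInto_cls (G : AdmGraph (r + 1)) (G' : AdmGraph (s + 1)) :
    insertInto K h j G (cls K G'.edge) = insertSum K h j G.edge G'.edge := by
  refine (Submodule.liftQ_apply (relations K (s + 1)) _ _).trans ?_
  rw [gen_of_adm, Finsupp.linearCombination_single, one_smul]

/-- The partial composition `x ∘ⱼ y` (with `j` counted from `0`) of `x ∈ dgraphs(r + 1)` and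
`y ∈ dgraphs(s + 1)`. -/
noncomputable def circ : DGraphs K (r + 1) →ₗ[K] DGraphs K (s + 1) →ₗ[K] DGraphs K (t + 1) :=
  (relations K (r + 1)).liftQ (Finsupp.linearCombination K (insertInto K h j))
    (by
      have hgen : ∀ {m e : ℕ} (E : Edges (r + 1) m e) (G' : AdmGraph (s + 1)),
          (∀ a, (E a).1 ≠ (E a).2) → Function.Injective E →
          Finsupp.linearCombination K (insertInto K h j) (gen K E) (cls K G'.edge)
            = insertSum K h j E G'.edge := by
        intro m e E G' h1 h2
        by_cases hE : Admissible E
        · rw [gen, dif_pos hE, Finsupp.linearCombination_single, one_smul, insertInto_cls]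
        · rw [gen_of_not K hE, map_zero, insertSum_eq_zero_left h j K _ h1 h2 hE,
            LinearMap.zero_apply]
      rw [relations, Submodule.span_le]
      rintro x hx
      rw [SetLike.mem_coe, LinearMap.mem_ker]
      refine Submodule.linearMap_qext (relations K (s + 1)) (Finsupp.lhom_ext' fun G' => ?_)
      apply LinearMap.ext_ring
      have hG : proj K (s + 1) (Finsupp.single G' 1) = cls K G'.edge := by
        rw [cls, gen_of_adm]
      change Finsupp.linearCombination K (insertInto K h j) x
        (proj K (s + 1) (Finsupp.single G' 1)) = 0
      rw [hG]
      cases hx with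
      | relabel E hE τ =>
        rw [map_sub, LinearMap.sub_apply, hgen E _ hE.noLoop hE.noDouble,
          hgen _ _ (hE.relabel τ).noLoop (hE.relabel τ).noDouble, insertSum_relabel_left, sub_self]
      | order E hE σ =>
        rw [map_sub, map_zsmul, LinearMap.sub_apply, LinearMap.smul_apply,
          hgen E _ hE.noLoop hE.noDouble,
          hgen _ _ (hE.comp_perm σ).noLoop (hE.comp_perm σ).noDouble, insertSum_order_left,
          sub_self]
      | ihx E v hE =>
        rw [map_sum, LinearMap.sum_apply, ← insertSum_ihx_left h j K E G'.edge hE.noLoop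
          hE.noDouble G'.adm.noLoop G'.adm.noDouble v]
        exact Finset.sum_congr rfl fun F hF => hgen _ _ (addEdge_noLoop hE.noLoop hF)
          (addEdge_noDouble hE.noDouble hE.noLoop hF))

/-- The partial composition of two graphs is given by insertion. -/
theorem circ_cls (G : AdmGraph (r + 1)) (G' : AdmGraph (s + 1)) :
    circ K h j (cls K G.edge) (cls K G'.edge) = insertSum K h j G.edge G'.edge := by
  have hG : circ K h j (cls K G.edge) = insertInto K h j G := by
    refine (Submodule.liftQ_apply (relations K (r + 1)) _ _).trans ?_
    rw [gen_of_adm, Finsupp.linearCombination_single, one_smul]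
  rw [hG, insertInto_cls]

end operad

section liealgebra

variable (K : Type*) [Field K]

/-- The space `∏_{n ≥ 1} dgraphs(n)` underlying the graded Lie algebra `g_{As, dgraphs}`; the
component with index `q` is the one with `n = q + 1`. -/
abbrev GraphLie : Type _ := ∀ q : ℕ, DGraphs K (q + 1)

/-- The elements of degree `k` of `g_{As, dgraphs} = ∏_{n ≥ 1} s^{-n+1} dgraphs(n)`: an element of
`dgraphs(n)` of degree `d` has degree `d + n - 1` there. -/
noncomputable def homogeneous (k : ℤ) : Submodule K (GraphLie K) :=
  Submodule.pi Set.univ fun q => degreePart K (q + 1) (k - q)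

/-- The pre-Lie product `x ⋆ y` for `y` of degree `l` in `g_{As, dgraphs}`: on `x ∈ dgraphs(n)` and
`y ∈ dgraphs(m)` it is `∑ᵢ (-1)^(|y| (1 - n) + (i + 1) (m - 1)) x ∘ᵢ y`, where here `n = p.1 + 1`,
`m = p.2 + 1`, `i = j + 1`, and where `|y| = l - (m - 1)` is the degree of `y` in `dgraphs(m)`. -/
noncomputable def star (l : ℤ) : GraphLie K →ₗ[K] GraphLie K →ₗ[K] GraphLie K :=
  LinearMap.mk₂ K
    (fun x y N => ∑ p : Finset.HasAntidiagonal.antidiagonal N, ∑ j : Fin (p.1.1 + 1),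
      (((l - p.1.2) * (1 - (p.1.1 + 1 : ℤ)) + ((j.val + 1 : ℤ) + 1) * p.1.2).negOnePow : ℤ) •
        circ K (Finset.HasAntidiagonal.mem_antidiagonal.1 p.2) j (x p.1.1) (y p.1.2))
    (fun x x' y => by
      funext N
      simp only [Pi.add_apply, map_add, LinearMap.add_apply, smul_add, Finset.sum_add_distrib])
    (fun c x y => by
      funext N
      simp only [Pi.smul_apply, map_smul, LinearMap.smul_apply, Finset.smul_sum]
      simp only [smul_comm c])
    (fun x y y' => by
      funext N
      simp only [Pi.add_apply, map_add, smul_add, Finset.sum_add_distrib])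
    (fun c x y => by
      funext N
      simp only [Pi.smul_apply, map_smul, Finset.smul_sum]
      simp only [smul_comm c])

/-- The graded Lie bracket `[x, y] = x ⋆ y - (-1)^(k l) y ⋆ x` of `x` of degree `k` and `y` of
degree `l`, as a linear map in `y`. -/
noncomputable def ad (k l : ℤ) (x : GraphLie K) : GraphLie K →ₗ[K] GraphLie K :=
  star K l x - ((k * l).negOnePow : ℤ) • (star K k).flip x

/-- The cocycles of degree `k` for `ad_α = [α, -]`, where `α` is of degree one. -/
noncomputable def cocycles (α : GraphLie K) (k : ℤ) : Submodule K (GraphLie K) :=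
  homogeneous K k ⊓ LinearMap.ker (ad K 1 k α)

/-- The coboundaries of degree `k` for `ad_α = [α, -]`, where `α` is of degree one. -/
noncomputable def coboundaries (α : GraphLie K) (k : ℤ) : Submodule K (GraphLie K) :=
  (homogeneous K (k - 1)).map (ad K 1 (k - 1) α)

/-- The cohomology `H^k(g_{As, dgraphs}, ad_α)`, for a Maurer-Cartan element `α` (for which
coboundaries are cocycles): cocycles modulo coboundaries. -/
abbrev Cohomology (α : GraphLie K) (k : ℤ) : Type _ :=
  cocycles K α k ⧸ (coboundaries K α k).submoduleOf (cocycles K α k)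

/-- The graph `a₁`: one external and one internal vertex joined by an edge, summed over the two
directions of this edge. -/
noncomputable def graphA₁ : DGraphs K 1 :=
  cls K (m := 1) (e := 1) ![(Sum.inr 0, Sum.inl 0)]
    + cls K (m := 1) (e := 1) ![(Sum.inl 0, Sum.inr 0)]

/-- The graph `a₂`: two external vertices and no edges. -/
noncomputable def graphA₂ : DGraphs K 2 :=
  cls K (m := 0) (e := 0) ![]

/-- The graph `b = b₁ + b₂ + b₃`: one internal vertex joined to three univalent external vertices
`1, 2, 3` by the first, second and third edge, summed over edge directions. -/
noncomputable def graphB : DGraphs K 3 :=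
  cls K (m := 1) (e := 3)
      ![(Sum.inl 0, Sum.inr 0), (Sum.inr 0, Sum.inl 1), (Sum.inr 0, Sum.inl 2)]
    + cls K (m := 1) (e := 3)
      ![(Sum.inr 0, Sum.inl 0), (Sum.inl 1, Sum.inr 0), (Sum.inr 0, Sum.inl 2)]
    + cls K (m := 1) (e := 3)
      ![(Sum.inr 0, Sum.inl 0), (Sum.inr 0, Sum.inl 1), (Sum.inl 2, Sum.inr 0)]

/-- The element `a₁ + a₂` of `g_{As, dgraphs}`. -/
noncomputable def alphaZero : GraphLie K :=
  Pi.single 0 (graphA₁ K) + Pi.single 1 (graphA₂ K)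

/-- The element `b` of `g_{As, dgraphs}`. -/
noncomputable def elementB : GraphLie K := Pi.single 2 (graphB K)

end liealgebra

end DirGraphs

/-! The element is closed by a direct computation, and it is not exact because a pair of linear
functionals separates it from all coboundaries.

Closedness. Let an undirected edge stand for the sum of its two directions. Then a₁ is an undirected
edge, and b is an undirected corolla with three legs, since the five remaining orientations of the
legs violate the degree conditions (`graphB_eq`). Sums over directions are handled by extending the
class of a graph multilinearly in its edges (`multiCls`); insertion then becomes pullback and
pushforward of formal sums of edges (`circ_multiCls`). In arity three, [a₁, b] is a sum of graphs
with two internal vertices. Those with four edges at one internal vertex vanish, those whose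
internal vertices are not joined cancel in pairs, and what remains is minus the generalized IHX
relation of the trivalent vertex (`graphA₁_bracket_graphB`). In arity four, [a₂, b] is an
alternating sum that telescopes (`graphA₂_bracket_graphB`).

Non-triviality. Let Φ on dgraphs(3) be the signed count of corollas with one incoming edge, and let
Ψ on dgraphs(4) be a suitable weight on pairs of disjoint directed edges. IHX relations involve only
graphs with at least two internal vertices, so any alternating weight on admissible graphs with at
most one internal vertex descends to the quotient (`functional`). For every x, Φ and Ψ see only the
component of [a₁ + a₂, x] coming from x₃ ∈ dgraphs(3): Φ reads the insertions of a₁ into x₃, and Ψ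
those of a₂ into x₃. Only graphs with two edges and no internal vertex matter there, and a finite
check (`weight_identity`) gives 2Φ + Ψ = 0 on all such brackets (`functional_ad_alphaZero`). But
Φ(b) = 3 and b has no component in arity four, so 2Φ + Ψ takes the value 6 on b. -/

namespace DirGraphs

/-! ### Components of the pre-Lie product in fixed arities -/

section star

variable (K : Type*) [Field K]

theorem star_apply (l : ℤ) (x y : GraphLie K) (N : ℕ) :
    star K l x y N = ∑ p : Finset.HasAntidiagonal.antidiagonal N, ∑ j : Fin (p.1.1 + 1),
      (((l - p.1.2) * (1 - (p.1.1 + 1 : ℤ)) + ((j.val + 1 : ℤ) + 1) * p.1.2).negOnePow : ℤ) •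
        circ K (Finset.HasAntidiagonal.mem_antidiagonal.1 p.2) j (x p.1.1) (y p.1.2) := rfl

/-- The part of the pre-Lie product coming from two fixed arities. -/
noncomputable def starTerm {p q N : ℕ} (h : p + q = N) (l : ℤ) (x : DGraphs K (p + 1))
    (y : DGraphs K (q + 1)) : DGraphs K (N + 1) :=
  ∑ j : Fin (p + 1), (((l - q) * (1 - (p + 1 : ℤ)) + ((j.val + 1 : ℤ) + 1) * q).negOnePow : ℤ) •
    circ K h j x y

theorem star_single_left {p q N : ℕ} (h : p + q = N) (l : ℤ) (x : DGraphs K (p + 1))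
    (y : GraphLie K) : star K l (Pi.single p x) y N = starTerm K h l x (y q) := by
  rw [star_apply, Finset.sum_eq_single ⟨(p, q), Finset.HasAntidiagonal.mem_antidiagonal.2 h⟩]
  · simp [starTerm]
  · rintro ⟨⟨a, b⟩, hab⟩ - hne
    have ha : a ≠ p := by
      rintro rfl
      have := Finset.HasAntidiagonal.mem_antidiagonal.1 hab
      apply hne
      simp only [Subtype.mk.injEq, Prod.mk.injEq, true_and]
      simp only at this
      omega
    simp [Pi.single_eq_of_ne ha]
  · simp

theorem star_single_right {p q N : ℕ} (h : p + q = N) (l : ℤ) (x : GraphLie K)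
    (y : DGraphs K (q + 1)) : star K l x (Pi.single q y) N = starTerm K h l (x p) y := by
  rw [star_apply, Finset.sum_eq_single ⟨(p, q), Finset.HasAntidiagonal.mem_antidiagonal.2 h⟩]
  · simp [starTerm]
  · rintro ⟨⟨a, b⟩, hab⟩ - hne
    have ha : b ≠ q := by
      rintro rfl
      have := Finset.HasAntidiagonal.mem_antidiagonal.1 hab
      apply hne
      simp only [Subtype.mk.injEq, Prod.mk.injEq, and_true]
      simp only at this
      omega
    simp [Pi.single_eq_of_ne ha]
  · simp

theorem star_single_single {p q N : ℕ} (h : p + q = N) (l : ℤ) (x : DGraphs K (p + 1))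
    (y : DGraphs K (q + 1)) :
    star K l (Pi.single p x) (Pi.single q y) = Pi.single N (starTerm K h l x y) := by
  funext M
  by_cases hM : M = N
  · subst hM
    rw [star_single_left K h, Pi.single_eq_same, Pi.single_eq_same]
  · rw [Pi.single_eq_of_ne hM, star_apply]
    refine Finset.sum_eq_zero ?_
    rintro ⟨⟨a, b⟩, hab⟩ -
    have hab' := Finset.HasAntidiagonal.mem_antidiagonal.1 hab
    refine Finset.sum_eq_zero fun j _ => ?_
    by_cases ha : a = p
    · have hb : b ≠ q := by
        rintro rfl
        subst ha
        exact hM (hab'.symm.trans h)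
      simp [Pi.single_eq_of_ne hb]
    · simp [Pi.single_eq_of_ne ha]

end star

/-! ### Partial compositions and functionals tested on graphs -/

section circ

variable (K : Type*) [Field K] {r s t : ℕ} (h : r + s = t) (j : Fin (r + 1))

/-- Insertion computes the partial composition also for graphs violating the degree conditions. -/
theorem circ_cls_cls {m e m' e' : ℕ} {E : Edges (r + 1) m e} {E' : Edges (s + 1) m' e'}
    (h1 : ∀ a, (E a).1 ≠ (E a).2) (h2 : Function.Injective E) (h3 : ∀ a, (E' a).1 ≠ (E' a).2)
    (h4 : Function.Injective E') (hc : ConnectedToExternal E') :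
    circ K h j (cls K E) (cls K E') = insertSum K h j E E' := by
  by_cases hE : Admissible E
  · by_cases hE' : Admissible E'
    · exact circ_cls K h j ⟨m, e, E, hE⟩ ⟨m', e', E', hE'⟩
    · rw [cls_of_not K hE', map_zero, insertSum_eq_zero_right h j K E h3 h4 hc hE']
  · rw [cls_of_not K hE, map_zero, LinearMap.zero_apply, insertSum_eq_zero_left h j K E' h1 h2 hE]

/-- Linear maps out of `dgraphs(n)` are determined by their values on admissible graphs. -/
theorem dgraphs_induction {n : ℕ} {f : DGraphs K n →ₗ[K] K}
    (hf : ∀ G : AdmGraph n, f (cls K G.edge) = 0) : f = 0 := by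
  refine Submodule.linearMap_qext (relations K n) (Finsupp.lhom_ext' fun G => ?_)
  apply LinearMap.ext_ring
  have hG : proj K n (Finsupp.single G 1) = cls K G.edge := by rw [cls, gen_of_adm]
  change f (proj K n (Finsupp.single G 1)) = 0
  rw [hG, hf]

end circ

/-! ### Functionals on the quotient from weights of small graphs -/

section functional

variable (K : Type*) [Field K] {n m₀ e₀ : ℕ}

/-- The value on a graph of a weight `D` of graphs with `m₀` internal vertices and `e₀` edges,
extended by zero. -/
def extendWeight (D : Edges n m₀ e₀ → ℤ) {m e : ℕ} (E : Edges n m e) : ℤ :=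
  if h : m = m₀ ∧ e = e₀ then D (h.1 ▸ h.2 ▸ E) else 0

theorem extendWeight_self (D : Edges n m₀ e₀ → ℤ) (E : Edges n m₀ e₀) :
    extendWeight D E = D E := by
  simp [extendWeight]

theorem extendWeight_of_ne (D : Edges n m₀ e₀ → ℤ) {m e : ℕ} (E : Edges n m e)
    (h : ¬ (m = m₀ ∧ e = e₀)) : extendWeight D E = 0 := by
  simp [extendWeight, h]

/-- An alternating weight on graphs with at most one internal vertex defines a functional. -/
noncomputable def functional (hm : m₀ ≤ 1) (D : Edges n m₀ e₀ → ℤ)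
    (hσ : ∀ E (σ : Equiv.Perm (Fin e₀)), D (E ∘ σ) = Equiv.Perm.sign σ * D E)
    (hD : ∀ E, D E ≠ 0 → Admissible E) : DGraphs K n →ₗ[K] K :=
  (relations K n).liftQ
    (Finsupp.linearCombination K fun G : AdmGraph n => (extendWeight D G.edge : K))
    (by
      have hgen : ∀ {m e : ℕ} (E : Edges n m e),
          Finsupp.linearCombination K (fun G : AdmGraph n => (extendWeight D G.edge : K))
            (gen K E) = extendWeight D E := by
        intro m e E
        by_cases hE : Admissible E
        · rw [gen, dif_pos hE, Finsupp.linearCombination_single, one_smul]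
        · rw [gen_of_not K hE, map_zero]
          by_cases h : m = m₀ ∧ e = e₀
          · obtain ⟨rfl, rfl⟩ := h
            rw [extendWeight_self]
            by_contra h0
            exact hE (hD E fun h1 => h0 (by rw [h1, Int.cast_zero]))
          · rw [extendWeight_of_ne D E h, Int.cast_zero]
      rw [relations, Submodule.span_le]
      rintro x hx
      rw [SetLike.mem_coe, LinearMap.mem_ker]
      cases hx with
      | @relabel m e E hE τ =>
        rw [map_sub, hgen, hgen]
        by_cases h : m = m₀ ∧ e = e₀
        · obtain ⟨rfl, rfl⟩ := h
          -- With at most one internal vertex the only relabeling is the identity.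
          have : Subsingleton (Fin m) := Fin.subsingleton_iff_le_one.2 hm
          rw [Subsingleton.elim τ 1]
          have h2 : mapV (Sum.map id (1 : Equiv.Perm (Fin m))) E = E := by
            funext a
            simp [mapV]
          rw [h2, sub_self]
        · rw [extendWeight_of_ne D _ h, extendWeight_of_ne D _ h, sub_self]
      | @order m e E hE σ =>
        rw [map_sub, map_zsmul, hgen, hgen]
        by_cases h : m = m₀ ∧ e = e₀
        · obtain ⟨rfl, rfl⟩ := h
          rw [extendWeight_self, extendWeight_self, hσ]
          simp
        · rw [extendWeight_of_ne D _ h, extendWeight_of_ne D _ h]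
          simp
      -- Every graph in an IHX relation has `m + 1 ≥ 2` internal vertices, because `v` exists; the
      -- weight ignores all of them.
      | @ihx m e E v hE =>
        rw [map_sum]
        refine Finset.sum_eq_zero fun F _ => ?_
        rw [hgen, extendWeight_of_ne D _ (by have := v.pos; omega), Int.cast_zero])

theorem functional_cls (hm : m₀ ≤ 1) (D : Edges n m₀ e₀ → ℤ)
    (hσ : ∀ E (σ : Equiv.Perm (Fin e₀)), D (E ∘ σ) = Equiv.Perm.sign σ * D E)
    (hD : ∀ E, D E ≠ 0 → Admissible E) {m e : ℕ} (E : Edges n m e) :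
    functional K hm D hσ hD (cls K E) = extendWeight D E := by
  by_cases hE : Admissible E
  · refine (Submodule.liftQ_apply (relations K n) _ _).trans ?_
    rw [gen, dif_pos hE, Finsupp.linearCombination_single, one_smul]
  · rw [cls_of_not K hE, map_zero]
    by_cases h : m = m₀ ∧ e = e₀
    · obtain ⟨rfl, rfl⟩ := h
      rw [extendWeight_self]
      by_contra h0
      exact hE (hD E fun h1 => h0 (by rw [h1, Int.cast_zero]))
    · rw [extendWeight_of_ne D E h, Int.cast_zero]

end functional

/-! ### The corolla weight and the pairing weight -/

section weights

/-- The coefficient of an edge at an internal vertex and the external vertex `k`, where `b` tells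
whether the edge is directed towards the internal vertex. -/
def legCoeff {n : ℕ} (b : Bool) (p : Vert n 1 × Vert n 1) (k : Fin n) : ℤ :=
  if p = (if b then (Sum.inl k, Sum.inr 0) else (Sum.inr 0, Sum.inl k)) then 1 else 0

/-- The signed count of the bijections from the edges to the external vertices which exhibit a graph
as a corolla with one incoming edge. -/
def corollaWeight (E : Edges 3 1 3) : ℤ :=
  ∑ c : Fin 3, Matrix.det (Matrix.of fun a k => legCoeff (decide (a = c)) (E a) k)

/-- Permuting the edges permutes the rows of each determinant and moves the position `c` of the
incoming edge along, so the sum over `c` is only reindexed. -/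
theorem corollaWeight_comp_perm (E : Edges 3 1 3) (σ : Equiv.Perm (Fin 3)) :
    corollaWeight (E ∘ σ) = Equiv.Perm.sign σ * corollaWeight E := by
  rw [corollaWeight, corollaWeight, Finset.mul_sum]
  refine Fintype.sum_equiv σ _ _ fun c => ?_
  -- `Matrix.det_permute` casts the sign into the coefficient ring, which is ℤ itself here.
  refine Eq.trans ?_ (congrArg (· * _) (Int.cast_id (n := Equiv.Perm.sign σ)))
  rw [← Matrix.det_permute]
  congr 1
  ext a k
  simp

/-- External vertices index the columns. This antisymmetry is what kills insertions of the symmetric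
graph a₂. -/
theorem corollaWeight_mapV (E : Edges 3 1 3) (τ : Equiv.Perm (Fin 3)) :
    corollaWeight (mapV (Sum.map τ id) E) = Equiv.Perm.sign τ * corollaWeight E := by
  rw [corollaWeight, corollaWeight, Finset.mul_sum]
  refine Finset.sum_congr rfl fun c _ => ?_
  have : ((Equiv.Perm.sign τ : ℤˣ) : ℤ) = (Equiv.Perm.sign τ.symm : ℤˣ) := by
    rw [Equiv.Perm.sign_symm]
  rw [this]
  refine Eq.trans ?_ (congrArg (· * _) (Int.cast_id (n := Equiv.Perm.sign τ.symm)))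
  rw [← Matrix.det_permute']
  congr 1
  ext a k
  simp only [Matrix.of_apply, Matrix.submatrix_apply, legCoeff, mapV, id]
  congr 1
  rcases E a with ⟨x | x, y | y⟩ <;> by_cases hc : a = c <;> simp [hc, Equiv.eq_symm_apply, eq_comm]

theorem corollaWeight_eq_zero {E : Edges 3 1 3} (k : Fin 3)
    (hk : ∀ a, (E a).1 ≠ Sum.inl k ∧ (E a).2 ≠ Sum.inl k) : corollaWeight E = 0 := by
  refine Finset.sum_eq_zero fun c _ => Matrix.det_eq_zero_of_column_eq_zero k fun a => ?_
  rw [Matrix.of_apply, legCoeff, if_neg]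
  intro h
  have := hk a
  rw [h] at this
  split_ifs at this <;> simp at this

/-- A nonzero determinant has a nonzero term in its Leibniz expansion, and the factors of that term
are indicators fixing each edge. -/
theorem exists_of_corollaWeight_ne_zero {E : Edges 3 1 3} (h : corollaWeight E ≠ 0) :
    ∃ (c : Fin 3) (σ : Equiv.Perm (Fin 3)), ∀ a, E a =
      if a = c then (Sum.inl (σ a), Sum.inr 0) else (Sum.inr 0, Sum.inl (σ a)) := by
  obtain ⟨c, -, hc⟩ := Finset.exists_ne_zero_of_sum_ne_zero h
  rw [← Matrix.det_transpose, Matrix.det_apply] at hc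
  obtain ⟨σ, -, hσ⟩ := Finset.exists_ne_zero_of_sum_ne_zero hc
  refine ⟨c, σ, fun a => ?_⟩
  have h1 : ∏ i, (Matrix.of fun a k => legCoeff (decide (a = c)) (E a) k).transpose (σ i) i ≠ 0 :=
    fun h0 => hσ (by rw [h0, smul_zero])
  have h2 := (Finset.prod_ne_zero_iff.1 h1) a (Finset.mem_univ a)
  simp only [Matrix.transpose_apply, Matrix.of_apply, legCoeff, decide_eq_true_eq] at h2
  by_contra h3
  exact h2 (if_neg h3)

theorem admissible_of_corollaWeight_ne_zero {E : Edges 3 1 3} (h : corollaWeight E ≠ 0) :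
    Admissible E := by
  obtain ⟨c, σ, hE⟩ := exists_of_corollaWeight_ne_zero h
  refine ⟨?_, ?_, ?_, ?_, ?_⟩
  · intro a b hab
    rw [hE, hE] at hab
    split_ifs at hab with h1 h2 h2
    · exact h1.trans h2.symm
    · simp at hab
    · simp at hab
    · simpa using hab
  · intro a
    rw [hE]
    split_ifs <;> simp
  · intro i
    rw [Subsingleton.elim i 0]
    refine ⟨σ 0, Relation.ReflTransGen.single ⟨0, ?_⟩⟩
    rw [hE]
    split_ifs <;> simp
  · intro i
    rw [inDeg, Finset.card_le_one]
    have key : ∀ a, (E a).2 = Sum.inr i → a = c := by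
      intro a ha
      by_contra hac
      rw [hE, if_neg hac] at ha
      simp at ha
    intro a ha b hb
    rw [key a (Finset.mem_filter.1 ha).2, key b (Finset.mem_filter.1 hb).2]
  · intro i
    have : (Finset.univ.filter fun a => (E a).1 = Sum.inr i) ⊆ Finset.univ.erase c := by
      intro a ha
      refine Finset.mem_erase.2 ⟨?_, Finset.mem_univ _⟩
      rintro rfl
      have := (Finset.mem_filter.1 ha).2
      rw [hE, if_pos rfl] at this
      simp at this
    exact (Finset.card_le_card this).trans (by simp)

/-- A function of two edges `(a, b)` and `(c, d)` between four external vertices, which vanishes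
unless these are pairwise distinct. -/
def pairingCoeff : Fin 4 → Fin 4 → Fin 4 → Fin 4 → ℤ
  -- After antisymmetrization these values are a solution of the linear equations in
  -- `weight_identity`; each listed line is a different unordered pair of directed edges.
  | 0, 2, 1, 3 => -1
  | 2, 0, 1, 3 => -2
  | 0, 2, 3, 1 => -2
  | 2, 0, 3, 1 => -1
  | 0, 3, 1, 2 => 1
  | 3, 0, 2, 1 => -1
  | 0, 1, 2, 3 => -1
  | 1, 0, 3, 2 => -1
  | 0, 1, 3, 2 => 2
  | _, _, _, _ => 0

/-- The antisymmetrization of `pairingCoeff`, a weight of graphs without internal vertices. -/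
def pairingWeight (E : Edges 4 0 2) : ℤ :=
  let f : Vert 4 0 → Fin 4 := Sum.elim id Fin.elim0
  pairingCoeff (f (E 0).1) (f (E 0).2) (f (E 1).1) (f (E 1).2)
    - pairingCoeff (f (E 1).1) (f (E 1).2) (f (E 0).1) (f (E 0).2)

theorem pairingWeight_comp_perm (E : Edges 4 0 2) (σ : Equiv.Perm (Fin 2)) :
    pairingWeight (E ∘ σ) = Equiv.Perm.sign σ * pairingWeight E := by
  obtain rfl | rfl : σ = 1 ∨ σ = Equiv.swap 0 1 := by
    revert σ
    decide
  · simp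
  · simp [pairingWeight]

theorem pairingCoeff_ne_zero : ∀ a b c d : Fin 4, pairingCoeff a b c d ≠ 0 →
    a ≠ b ∧ a ≠ c ∧ a ≠ d ∧ b ≠ c ∧ b ≠ d ∧ c ≠ d := by
  decide +kernel

theorem pairingWeight_ne_zero {E : Edges 4 0 2} (h : pairingWeight E ≠ 0) :
    (E 0).1 ≠ (E 0).2 ∧ (E 0).1 ≠ (E 1).1 ∧ (E 0).1 ≠ (E 1).2 ∧ (E 0).2 ≠ (E 1).1 ∧
      (E 0).2 ≠ (E 1).2 ∧ (E 1).1 ≠ (E 1).2 := by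
  let f : Vert 4 0 → Fin 4 := Sum.elim id Fin.elim0
  have key : ∀ a b c d : Vert 4 0, pairingCoeff (f a) (f b) (f c) (f d) ≠ 0 →
      a ≠ b ∧ a ≠ c ∧ a ≠ d ∧ b ≠ c ∧ b ≠ d ∧ c ≠ d := by
    intro a b c d hh
    obtain ⟨h1, h2, h3, h4, h5, h6⟩ := pairingCoeff_ne_zero _ _ _ _ hh
    exact ⟨ne_of_apply_ne f h1, ne_of_apply_ne f h2, ne_of_apply_ne f h3, ne_of_apply_ne f h4,
      ne_of_apply_ne f h5, ne_of_apply_ne f h6⟩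
  by_cases h1 : pairingCoeff (f (E 0).1) (f (E 0).2) (f (E 1).1) (f (E 1).2) = 0
  · have h2 : pairingCoeff (f (E 1).1) (f (E 1).2) (f (E 0).1) (f (E 0).2) ≠ 0 := by
      intro h2
      apply h
      change pairingCoeff (f (E 0).1) (f (E 0).2) (f (E 1).1) (f (E 1).2)
        - pairingCoeff (f (E 1).1) (f (E 1).2) (f (E 0).1) (f (E 0).2) = 0
      rw [h1, h2, sub_zero]
    obtain ⟨h1, h2, h3, h4, h5, h6⟩ := key _ _ _ _ h2
    exact ⟨h6, h2.symm, h4.symm, h3.symm, h5.symm, h1⟩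
  · exact key _ _ _ _ h1

theorem admissible_of_pairingWeight_ne_zero {E : Edges 4 0 2} (h : pairingWeight E ≠ 0) :
    Admissible E := by
  obtain ⟨h1, h2, h3, h4, h5, h6⟩ := pairingWeight_ne_zero h
  refine ⟨?_, ?_, fun i => i.elim0, fun i => i.elim0, fun i => i.elim0⟩
  · intro a b hab
    fin_cases a <;> fin_cases b <;> simp at hab ⊢
    · exact h2 (congrArg Prod.fst hab)
    · exact h2 (congrArg Prod.fst hab).symm
  · intro a
    fin_cases a
    · exact h1
    · exact h6

/-- By pigeonhole: a nonzero weight needs four distinct endpoints, and these together with `k` would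
be five vertices out of four. -/
theorem pairingWeight_eq_zero {E : Edges 4 0 2} (k : Fin 4)
    (hk : ∀ a, (E a).1 ≠ Sum.inl k ∧ (E a).2 ≠ Sum.inl k) : pairingWeight E = 0 := by
  by_contra h
  obtain ⟨h1, h2, h3, h4, h5, h6⟩ := pairingWeight_ne_zero h
  have hcard : ({Sum.inl k, (E 0).1, (E 0).2, (E 1).1, (E 1).2} : Finset (Vert 4 0)).card = 5 := by
    rw [Finset.card_insert_of_notMem, Finset.card_insert_of_notMem, Finset.card_insert_of_notMem,
      Finset.card_pair h6]
    · simp [h4, h5]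
    · simp [h1, h2, h3]
    · simp [(hk 0).1.symm, (hk 0).2.symm, (hk 1).1.symm, (hk 1).2.symm]
  have := Finset.card_le_univ
    ({Sum.inl k, (E 0).1, (E 0).2, (E 1).1, (E 1).2} : Finset (Vert 4 0))
  rw [hcard] at this
  simp at this

end weights

/-! ### The two functionals -/

section functionals

variable (K : Type*) [Field K]

/-- The functional on `dgraphs(3)` given by `corollaWeight`. -/
noncomputable def corollaFunctional : DGraphs K 3 →ₗ[K] K :=
  functional K le_rfl corollaWeight corollaWeight_comp_perm
    fun _ => admissible_of_corollaWeight_ne_zero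

/-- The functional on `dgraphs(4)` given by `pairingWeight`. -/
noncomputable def pairingFunctional : DGraphs K 4 →ₗ[K] K :=
  functional K zero_le_one pairingWeight pairingWeight_comp_perm
    fun _ => admissible_of_pairingWeight_ne_zero

theorem corollaFunctional_cls (E : Edges 3 1 3) :
    corollaFunctional K (cls K E) = corollaWeight E := by
  rw [corollaFunctional, functional_cls, extendWeight_self]

theorem corollaFunctional_cls_of_ne {m e : ℕ} (E : Edges 3 m e) (h : ¬ (m = 1 ∧ e = 3)) :
    corollaFunctional K (cls K E) = 0 := by
  rw [corollaFunctional, functional_cls, extendWeight_of_ne _ _ h, Int.cast_zero]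

theorem pairingFunctional_cls (E : Edges 4 0 2) :
    pairingFunctional K (cls K E) = pairingWeight E := by
  rw [pairingFunctional, functional_cls, extendWeight_self]

theorem pairingFunctional_cls_of_ne {m e : ℕ} (E : Edges 4 m e) (h : ¬ (m = 0 ∧ e = 2)) :
    pairingFunctional K (cls K E) = 0 := by
  rw [pairingFunctional, functional_cls, extendWeight_of_ne _ _ h, Int.cast_zero]

end functionals

/-! ### Terms of the differential which the functionals do not see -/

section vanishing

variable (K : Type*) [Field K]

theorem corollaFunctional_cls_of_isolated {m e : ℕ} (E : Edges 3 m e) (k : Fin 3)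
    (hk : ∀ a, (E a).1 ≠ Sum.inl k ∧ (E a).2 ≠ Sum.inl k) : corollaFunctional K (cls K E) = 0 := by
  by_cases h : m = 1 ∧ e = 3
  · obtain ⟨rfl, rfl⟩ := h
    rw [corollaFunctional_cls, corollaWeight_eq_zero k hk, Int.cast_zero]
  · exact corollaFunctional_cls_of_ne K E h

theorem pairingFunctional_cls_of_isolated {m e : ℕ} (E : Edges 4 m e) (k : Fin 4)
    (hk : ∀ a, (E a).1 ≠ Sum.inl k ∧ (E a).2 ≠ Sum.inl k) : pairingFunctional K (cls K E) = 0 := by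
  by_cases h : m = 0 ∧ e = 2
  · obtain ⟨rfl, rfl⟩ := h
    rw [pairingFunctional_cls, pairingWeight_eq_zero k hk, Int.cast_zero]
  · exact pairingFunctional_cls_of_ne K E h

theorem corollaFunctional_cls_mapV {m e : ℕ} (E : Edges 3 m e) (τ : Equiv.Perm (Fin 3)) :
    corollaFunctional K (cls K (mapV (Sum.map τ id) E))
      = (Equiv.Perm.sign τ : ℤ) * corollaFunctional K (cls K E) := by
  by_cases h : m = 1 ∧ e = 3
  · obtain ⟨rfl, rfl⟩ := h
    rw [corollaFunctional_cls, corollaFunctional_cls, corollaWeight_mapV, Int.cast_mul]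
  · rw [corollaFunctional_cls_of_ne K _ h, corollaFunctional_cls_of_ne K _ h, mul_zero]

theorem corollaFunctional_cls_of_external {m e : ℕ} (E : Edges 3 m e) (a : Fin e) (k l : Fin 3)
    (ha : E a = (Sum.inl k, Sum.inl l)) : corollaFunctional K (cls K E) = 0 := by
  by_cases h : m = 1 ∧ e = 3
  · obtain ⟨rfl, rfl⟩ := h
    rw [corollaFunctional_cls]
    by_contra h0
    obtain ⟨c, σ, hE⟩ := exists_of_corollaWeight_ne_zero
      (E := E) fun h1 => h0 (by rw [h1, Int.cast_zero])
    have := hE a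
    rw [ha] at this
    split_ifs at this <;> simp at this
  · exact corollaFunctional_cls_of_ne K E h

/-- The graph a₂ has no edges, so its external vertex other than `j` stays isolated after the
insertion. Stated for a general `f` in order to serve both functionals. -/
theorem circ_graphA₂_left {s t : ℕ} (h : 1 + s = t) (j : Fin 2) (f : DGraphs K (t + 1) →ₗ[K] K)
    (hf : ∀ {m e : ℕ} (E : Edges (t + 1) m e) (k : Fin (t + 1)),
      (∀ a, (E a).1 ≠ Sum.inl k ∧ (E a).2 ≠ Sum.inl k) → f (cls K E) = 0)
    (x : DGraphs K (s + 1)) : f (circ K h j (graphA₂ K) x) = 0 := by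
  refine LinearMap.congr_fun (f := f ∘ₗ circ K h j (graphA₂ K)) (g := 0) ?_ x
  refine dgraphs_induction K fun G => ?_
  rw [LinearMap.comp_apply, graphA₂, circ_cls_cls K h j (fun a => a.elim0) (fun a => a.elim0)
    G.adm.noLoop G.adm.noDouble G.adm.connected, insertSum, map_sum]
  refine Finset.sum_eq_zero fun F _ => ?_
  have hemb : ∀ (k : Fin (t + 1)), (k.val < j.val ∨ j.val + s < k.val) →
      ∀ u : Vert (s + 1) G.m, embed h j 0 G.m u ≠ Sum.inl k := by
    rintro k hk (u | u) hu
    · simp only [embed, Sum.map_inl, Sum.inl.injEq, Fin.ext_iff] at hu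
      omega
    · simp [embed] at hu
  -- The inserted graph occupies the positions from `j` to `j + s`; the one left over is the last if
  -- `j = 0` and the first if `j = 1`.
  obtain ⟨k, hk⟩ : ∃ k : Fin (t + 1), k.val < j.val ∨ j.val + s < k.val := by
    by_cases hj : j.val = 0
    · exact ⟨Fin.last t, Or.inr (by simp; omega)⟩
    · exact ⟨0, Or.inl (by simp; omega)⟩
  refine hf _ k fun a => ?_
  refine Fin.addCases (fun a => a.elim0) (fun a => ?_) a
  rw [Fin.append_right]
  exact ⟨hemb k hk _, hemb k hk _⟩

/-- Inserting a₂ at `j` gives a sum symmetric under exchanging the two new external vertices, while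
the corolla functional is antisymmetric. -/
theorem corollaFunctional_circ_graphA₂ [CharZero K] (j : Fin 2) (x : DGraphs K 2) :
    corollaFunctional K (circ K (rfl : 1 + 1 = 2) j x (graphA₂ K)) = 0 := by
  refine LinearMap.congr_fun
    (f := corollaFunctional K ∘ₗ (circ K (rfl : 1 + 1 = 2) j).flip (graphA₂ K)) (g := 0) ?_ x
  refine dgraphs_induction K fun G => ?_
  rw [LinearMap.comp_apply, LinearMap.flip_apply, graphA₂, circ_cls_cls K _ j G.adm.noLoop
    G.adm.noDouble (fun a => a.elim0) (fun a => a.elim0) (fun a => a.elim0), insertSum, map_sum]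
  let τ : Equiv.Perm (Fin 3) := Equiv.swap j.castSucc j.succ
  have hτ : Equiv.Perm.sign τ = -1 := Equiv.Perm.sign_swap (Fin.castSucc_lt_succ).ne
  have hcol : ∀ {m : ℕ} (v : Vert 3 (m + 0)),
      collapse (rfl : 1 + 1 = 2) j m 0 (Sum.map τ id v)
        = collapse (rfl : 1 + 1 = 2) j m 0 v := by
    rintro m (v | v)
    · change Sum.inl _ = Sum.inl _
      congr 1
      revert v j
      decide
    · rfl
  have hinv : ∀ v : Vert 3 (G.m + 0), Sum.map τ id (Sum.map τ id v) = v := by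
    rintro (v | v) <;> simp [τ]
  set S := ∑ F ∈ lifts (collapse (rfl : 1 + 1 = 2) j G.m 0) G.edge,
    corollaFunctional K (cls K (Fin.append F (mapV (embed (rfl : 1 + 1 = 2) j G.m 0) ![]))) with hS
  -- The transposition preserves the collapse map, so it acts on the set of lifts and reverses the
  -- sign of each summand.
  have hneg : S = - S := by
    conv_lhs => rw [hS]
    rw [hS, ← Finset.sum_neg_distrib]
    refine Finset.sum_bij' (fun F _ => mapV (Sum.map τ id) F) (fun F _ => mapV (Sum.map τ id) F)
      ?_ ?_ ?_ ?_ ?_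
    · intro F hF
      rw [mem_lifts] at hF ⊢
      rw [mapV_mapV, ← hF]
      exact congrArg (fun f => mapV f F) (funext hcol)
    · intro F hF
      rw [mem_lifts] at hF ⊢
      rw [mapV_mapV, ← hF]
      exact congrArg (fun f => mapV f F) (funext hcol)
    · intro F _
      rw [mapV_mapV]
      exact congrArg (fun f => mapV f F) (funext hinv)
    · intro F _
      rw [mapV_mapV]
      exact congrArg (fun f => mapV f F) (funext hinv)
    · intro F _
      have h1 : Fin.append (mapV (Sum.map τ id) F) (mapV (embed (rfl : 1 + 1 = 2) j G.m 0) ![])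
          = mapV (Sum.map τ id) (Fin.append F (mapV (embed (rfl : 1 + 1 = 2) j G.m 0) ![])) := by
        rw [mapV_append]
        congr 1
        funext a
        exact a.elim0
      rw [h1, corollaFunctional_cls_mapV, hτ]
      simp
  simpa [CharZero.eq_neg_self_iff] using hneg

theorem circ_graphA₁ {r t : ℕ} (h : r + 0 = t) (j : Fin (r + 1)) {m e : ℕ}
    {E : Edges (r + 1) m e} (hE : Admissible E) :
    circ K h j (cls K E) (graphA₁ K)
      = insertSum K h j E (s := 0) (m' := 1) (e' := 1) ![(Sum.inr 0, Sum.inl 0)]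
        + insertSum K h j E (s := 0) (m' := 1) (e' := 1) ![(Sum.inl 0, Sum.inr 0)] := by
  rw [graphA₁, map_add, circ_cls_cls K h j hE.noLoop hE.noDouble,
    circ_cls_cls K h j hE.noLoop hE.noDouble]
  · simp
  · exact Function.injective_of_subsingleton _
  · exact fun i => ⟨0, .single ⟨0, Or.inr (by simp [Subsingleton.elim i 0])⟩⟩
  · simp
  · exact Function.injective_of_subsingleton _
  · exact fun i => ⟨0, .single ⟨0, Or.inl (by simp [Subsingleton.elim i 0])⟩⟩

theorem graphA₁_circ {s t : ℕ} (h : 0 + s = t) (j : Fin 1) {m e : ℕ}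
    {E : Edges (s + 1) m e} (hE : Admissible E) :
    circ K h j (graphA₁ K) (cls K E)
      = insertSum K h j (r := 0) (m := 1) (e := 1) ![(Sum.inr 0, Sum.inl 0)] E
        + insertSum K h j (r := 0) (m := 1) (e := 1) ![(Sum.inl 0, Sum.inr 0)] E := by
  rw [graphA₁, map_add, LinearMap.add_apply, circ_cls_cls K h j _ _ hE.noLoop hE.noDouble
    hE.connected, circ_cls_cls K h j _ _ hE.noLoop hE.noDouble hE.connected]
  · simp
  · exact Function.injective_of_subsingleton _
  · simp
  · exact Function.injective_of_subsingleton _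

/-- To produce one internal vertex and three edges, the inserted graph must have two edges and no
internal vertex. Its edges then join external vertices, which never happens in a corolla. -/
theorem corollaFunctional_graphA₁_circ (j : Fin 1) (x : DGraphs K 3) :
    corollaFunctional K (circ K (rfl : 0 + 2 = 2) j (graphA₁ K) x) = 0 := by
  refine LinearMap.congr_fun
    (f := corollaFunctional K ∘ₗ circ K (rfl : 0 + 2 = 2) j (graphA₁ K)) (g := 0) ?_ x
  refine dgraphs_induction K fun ⟨m, e, E, hE⟩ => ?_
  have key : ∀ E₁ : Edges 1 1 1,
      corollaFunctional K (insertSum K (rfl : 0 + 2 = 2) j E₁ E) = 0 := by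
    intro E₁
    rw [insertSum, map_sum]
    refine Finset.sum_eq_zero fun F _ => ?_
    by_cases hme : m = 0 ∧ e = 2
    · obtain ⟨rfl, rfl⟩ := hme
      rcases h1 : E 0 with ⟨u | u, v | v⟩
      · refine corollaFunctional_cls_of_external K _ (Fin.natAdd 1 (0 : Fin 2))
          ⟨j.val + u.val, by omega⟩ ⟨j.val + v.val, by omega⟩ ?_
        rw [Fin.append_right, mapV, h1]
        rfl
      all_goals first | exact u.elim0 | exact v.elim0
    · exact corollaFunctional_cls_of_ne K _ (by omega)
  rw [LinearMap.comp_apply, graphA₁_circ K _ j hE, map_add, key, key, add_zero]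

/-- Composing with a₁ on either side creates an internal vertex, and the pairing weight lives on
graphs without any. -/
theorem pairingFunctional_graphA₁_circ (j : Fin 1) (x : DGraphs K 4) :
    pairingFunctional K (circ K (rfl : 0 + 3 = 3) j (graphA₁ K) x) = 0 := by
  refine LinearMap.congr_fun
    (f := pairingFunctional K ∘ₗ circ K (rfl : 0 + 3 = 3) j (graphA₁ K)) (g := 0) ?_ x
  refine dgraphs_induction K fun ⟨m, e, E, hE⟩ => ?_
  rw [LinearMap.comp_apply, graphA₁_circ K _ j hE, map_add, insertSum, insertSum, map_sum, map_sum,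
    Finset.sum_eq_zero, Finset.sum_eq_zero, add_zero]
  all_goals exact fun F _ => pairingFunctional_cls_of_ne K _ (by omega)

theorem pairingFunctional_circ_graphA₁ (j : Fin 4) (x : DGraphs K 4) :
    pairingFunctional K (circ K (rfl : 3 + 0 = 3) j x (graphA₁ K)) = 0 := by
  refine LinearMap.congr_fun
    (f := pairingFunctional K ∘ₗ (circ K (rfl : 3 + 0 = 3) j).flip (graphA₁ K))
    (g := 0) ?_ x
  refine dgraphs_induction K fun ⟨m, e, E, hE⟩ => ?_
  rw [LinearMap.comp_apply, LinearMap.flip_apply, circ_graphA₁ K _ j hE, map_add, insertSum,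
    insertSum, map_sum, map_sum, Finset.sum_eq_zero, Finset.sum_eq_zero, add_zero]
  all_goals exact fun F _ => pairingFunctional_cls_of_ne K _ (by omega)

end vanishing

/-! ### The identity between the two functionals on brackets -/

section identity

/-- Turns a sum over reconnected graphs into a double sum over single edges, the form in which
`weight_identity` is decided. -/
theorem sum_lifts_two {M : Type*} [AddCommMonoid M] {n m n' m' : ℕ} (f : Vert n' m' → Vert n m)
    (E : Edges n m 2) (φ : Edges n' m' 2 → M) :
    ∑ F ∈ lifts f E, φ F = ∑ p with Prod.map f f p = E 0, ∑ q with Prod.map f f q = E 1,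
      φ ![p, q] := by
  rw [← Finset.sum_product']
  refine Finset.sum_bij' (fun F _ => (F 0, F 1)) (fun p _ => ![p.1, p.2]) ?_ ?_ ?_ ?_ ?_
  · intro F hF
    rw [mem_lifts] at hF
    simp [← hF, mapV]
  · rintro ⟨p, q⟩ h
    simp only [Finset.mem_product, Finset.mem_filter, Finset.mem_univ, true_and] at h
    rw [mem_lifts]
    funext a
    fin_cases a
    · exact h.1
    · exact h.2
  · intro F _
    funext a
    fin_cases a <;> rfl
  · intros
    rfl
  · intro F _
    congr 1
    funext a
    fin_cases a <;> rfl

/-- The determinant written out, so that evaluation is plain integer arithmetic. -/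
theorem corollaWeight_vec (p q r : Vert 3 1 × Vert 3 1) : corollaWeight ![p, q, r] =
    ∑ c : Fin 3,
      let x := legCoeff (decide (0 = c)) p
      let y := legCoeff (decide (1 = c)) q
      let z := legCoeff (decide (2 = c)) r
      x 0 * y 1 * z 2 - x 0 * y 2 * z 1 - x 1 * y 0 * z 2 + x 1 * y 2 * z 0 + x 2 * y 0 * z 1
        - x 2 * y 1 * z 0 := by
  rw [corollaWeight]
  refine Finset.sum_congr rfl fun c _ => ?_
  rw [Matrix.det_fin_three]
  rfl

/-- The relevant case is two edges sharing exactly one vertex `j`. Inserting a₁ at `j` with both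
edges moved to the new internal vertex gives corollas; inserting a₂ at `j` with the edges separated
gives pairs of disjoint edges. Insertions elsewhere have weight zero. The whole statement is a
finite check over pairs of directed edges on three vertices. -/
theorem weight_identity : ∀ p₀ q₀ : Vert 3 0 × Vert 3 0, p₀.1 ≠ p₀.2 → q₀.1 ≠ q₀.2 →
    2 * ∑ j : Fin 3,
      (∑ p with Prod.map (collapse (rfl : 2 + 0 = 2) j 0 1)
          (collapse (rfl : 2 + 0 = 2) j 0 1) p = p₀,
        ∑ q with Prod.map (collapse (rfl : 2 + 0 = 2) j 0 1)
          (collapse (rfl : 2 + 0 = 2) j 0 1) q = q₀,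
        corollaWeight ![p, q, Prod.map (embed (rfl : 2 + 0 = 2) j 0 1)
          (embed (rfl : 2 + 0 = 2) j 0 1) (Sum.inr 0, Sum.inl 0)]
      + ∑ p with Prod.map (collapse (rfl : 2 + 0 = 2) j 0 1)
          (collapse (rfl : 2 + 0 = 2) j 0 1) p = p₀,
        ∑ q with Prod.map (collapse (rfl : 2 + 0 = 2) j 0 1)
          (collapse (rfl : 2 + 0 = 2) j 0 1) q = q₀,
        corollaWeight ![p, q, Prod.map (embed (rfl : 2 + 0 = 2) j 0 1)
          (embed (rfl : 2 + 0 = 2) j 0 1) (Sum.inl 0, Sum.inr 0)])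
    + ∑ j : Fin 3, (-1) ^ j.val *
      ∑ p with Prod.map (collapse (rfl : 2 + 1 = 3) j 0 0)
          (collapse (rfl : 2 + 1 = 3) j 0 0) p = p₀,
        ∑ q with Prod.map (collapse (rfl : 2 + 1 = 3) j 0 0)
          (collapse (rfl : 2 + 1 = 3) j 0 0) q = q₀, pairingWeight ![p, q] = 0 := by
  simp only [corollaWeight_vec]
  decide +kernel

theorem corollaFunctional_insertSum (K : Type*) [Field K] (E : Edges 3 0 2) (j : Fin 3)
    (p₀ : Vert 1 1 × Vert 1 1) :
    corollaFunctional K (insertSum K (rfl : 2 + 0 = 2) j E (m' := 1) (e' := 1) ![p₀])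
      = ((∑ p with Prod.map (collapse (rfl : 2 + 0 = 2) j 0 1)
          (collapse (rfl : 2 + 0 = 2) j 0 1) p = E 0,
        ∑ q with Prod.map (collapse (rfl : 2 + 0 = 2) j 0 1)
          (collapse (rfl : 2 + 0 = 2) j 0 1) q = E 1,
        corollaWeight ![p, q, Prod.map (embed (rfl : 2 + 0 = 2) j 0 1)
          (embed (rfl : 2 + 0 = 2) j 0 1) p₀] : ℤ) : K) := by
  rw [insertSum, map_sum, sum_lifts_two, Int.cast_sum]
  refine Finset.sum_congr rfl fun p _ => ?_
  rw [Int.cast_sum]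
  refine Finset.sum_congr rfl fun q _ => ?_
  refine (corollaFunctional_cls K _).trans (congrArg (fun F => (corollaWeight F : K)) ?_)
  funext a
  fin_cases a <;> rfl

theorem pairingFunctional_insertSum (K : Type*) [Field K] (E : Edges 3 0 2) (j : Fin 3) :
    pairingFunctional K (insertSum K (rfl : 2 + 1 = 3) j E (m' := 0) (e' := 0) ![])
      = ((∑ p with Prod.map (collapse (rfl : 2 + 1 = 3) j 0 0)
          (collapse (rfl : 2 + 1 = 3) j 0 0) p = E 0,
        ∑ q with Prod.map (collapse (rfl : 2 + 1 = 3) j 0 0)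
          (collapse (rfl : 2 + 1 = 3) j 0 0) q = E 1, pairingWeight ![p, q] : ℤ) : K) := by
  rw [insertSum, map_sum, sum_lifts_two, Int.cast_sum]
  refine Finset.sum_congr rfl fun p _ => ?_
  rw [Int.cast_sum]
  refine Finset.sum_congr rfl fun q _ => ?_
  refine (pairingFunctional_cls K _).trans (congrArg (fun F => (pairingWeight F : K)) ?_)
  funext a
  fin_cases a <;> rfl

/-- The left side is linear in `x`, so it suffices to test graphs, where the claim is
`weight_identity`. -/
theorem corollaFunctional_add_pairingFunctional (K : Type*) [Field K] (x : DGraphs K 3) :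
    2 * ∑ j : Fin 3, corollaFunctional K (circ K (rfl : 2 + 0 = 2) j x (graphA₁ K))
      + ∑ j : Fin 3, (-1) ^ j.val *
        pairingFunctional K (circ K (rfl : 2 + 1 = 3) j x (graphA₂ K)) = 0 := by
  let f : DGraphs K 3 →ₗ[K] K :=
    (2 : K) • ∑ j : Fin 3, corollaFunctional K ∘ₗ
        (circ K (rfl : 2 + 0 = 2) j).flip (graphA₁ K)
      + ∑ j : Fin 3, ((-1) ^ j.val : K) • (pairingFunctional K ∘ₗ
        (circ K (rfl : 2 + 1 = 3) j).flip (graphA₂ K))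
  have hf : ∀ x, f x = 2 * ∑ j : Fin 3, corollaFunctional K (circ K (rfl : 2 + 0 = 2) j x
      (graphA₁ K)) + ∑ j : Fin 3, (-1) ^ j.val *
        pairingFunctional K (circ K (rfl : 2 + 1 = 3) j x (graphA₂ K)) := by
    intro x
    simp [f, LinearMap.sum_apply]
  rw [← hf]
  refine LinearMap.congr_fun (f := f) (g := 0) ?_ x
  refine dgraphs_induction K fun ⟨m, e, E, hE⟩ => ?_
  have h1 : ∀ j, circ K (rfl : 2 + 1 = 3) j (cls K E) (graphA₂ K)
      = insertSum K (rfl : 2 + 1 = 3) j E (m' := 0) (e' := 0) ![] := fun j =>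
    circ_cls_cls K _ j hE.noLoop hE.noDouble (fun a => a.elim0) (fun a => a.elim0)
      (fun a => a.elim0)
  have h2 : ∀ j, circ K (rfl : 2 + 0 = 2) j (cls K E) (graphA₁ K) = _ :=
    fun j => circ_graphA₁ K _ j hE
  rw [hf]
  simp only [h1, h2, map_add]
  -- Inserting a₁ adds one internal vertex and one edge, inserting a₂ adds neither, so graphs of any
  -- other size are invisible to both functionals.
  by_cases hme : m = 0 ∧ e = 2
  · obtain ⟨rfl, rfl⟩ := hme
    have key := weight_identity (E 0) (E 1) (hE.noLoop 0) (hE.noLoop 1)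
    simp only [corollaFunctional_insertSum, pairingFunctional_insertSum]
    refine Eq.trans ?_ ((congrArg (Int.cast : ℤ → K) key).trans Int.cast_zero)
    push_cast
    rfl
  · have h3 : ∀ F : Edges 3 (m + 1) (e + 1), corollaFunctional K (cls K F) = 0 :=
      fun F => corollaFunctional_cls_of_ne K F (by omega)
    have h4 : ∀ F : Edges 4 (m + 0) (e + 0), pairingFunctional K (cls K F) = 0 :=
      fun F => pairingFunctional_cls_of_ne K F (by omega)
    rw [Finset.sum_eq_zero, Finset.sum_eq_zero, mul_zero, add_zero]
    · intro j _
      rw [insertSum, map_sum, Finset.sum_eq_zero fun F _ => h4 _, mul_zero]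
    · intro j _
      rw [insertSum, insertSum, map_sum, map_sum, Finset.sum_eq_zero fun F _ => h3 _,
        Finset.sum_eq_zero fun F _ => h3 _, add_zero]

/-- In each of the two arities the vanishing lemmas leave only insertions into `x 2`. The bracket
sign for degrees one and zero is -1. In the pre-Lie sign, a₁ contributes an even exponent and a₂ the
factor `(-1) ^ j`, exactly the signs of `corollaFunctional_add_pairingFunctional`. -/
theorem functional_ad_alphaZero (K : Type*) [Field K] [CharZero K] (x : GraphLie K) :
    2 * corollaFunctional K (ad K 1 0 (alphaZero K) x 2)
      + pairingFunctional K (ad K 1 0 (alphaZero K) x 3) = 0 := by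
  have h2 : corollaFunctional K (ad K 1 0 (alphaZero K) x 2)
      = - ∑ j : Fin 3, corollaFunctional K (circ K (rfl : 2 + 0 = 2) j (x 2)
        (graphA₁ K)) := by
    simp only [ad, alphaZero, map_add, LinearMap.add_apply, LinearMap.sub_apply, Pi.add_apply,
      Pi.sub_apply, LinearMap.smul_apply, Pi.smul_apply, LinearMap.flip_apply]
    rw [star_single_left K (rfl : 0 + 2 = 2), star_single_left K (rfl : 1 + 1 = 2),
      star_single_right K (rfl : 2 + 0 = 2), star_single_right K (rfl : 1 + 1 = 2)]
    simp only [starTerm, map_add, map_sub, map_sum, map_zsmul, corollaFunctional_graphA₁_circ,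
      corollaFunctional_circ_graphA₂, circ_graphA₂_left K _ _ (corollaFunctional K)
        (corollaFunctional_cls_of_isolated K)]
    simp [Fin.sum_univ_three, Int.negOnePow_even _ (show Even (-2 : ℤ) by decide)]
  have h3 : pairingFunctional K (ad K 1 0 (alphaZero K) x 3)
      = - ∑ j : Fin 3, (-1) ^ j.val *
        pairingFunctional K (circ K (rfl : 2 + 1 = 3) j (x 2) (graphA₂ K)) := by
    simp only [ad, alphaZero, map_add, LinearMap.add_apply, LinearMap.sub_apply, Pi.add_apply,
      Pi.sub_apply, LinearMap.smul_apply, Pi.smul_apply, LinearMap.flip_apply]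
    rw [star_single_left K (rfl : 0 + 3 = 3), star_single_left K (rfl : 1 + 2 = 3),
      star_single_right K (rfl : 3 + 0 = 3), star_single_right K (rfl : 2 + 1 = 3)]
    simp only [starTerm, map_add, map_sub, map_sum, map_zsmul, pairingFunctional_graphA₁_circ,
      pairingFunctional_circ_graphA₁, circ_graphA₂_left K _ _ (pairingFunctional K)
        (pairingFunctional_cls_of_isolated K)]
    simp [Fin.sum_univ_three]
    ring
  rw [h2, h3]
  linear_combination - corollaFunctional_add_pairingFunctional K (x 2)

theorem corollaFunctional_graphB (K : Type*) [Field K] : corollaFunctional K (graphB K) = 3 := by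
  rw [graphB, map_add, map_add, corollaFunctional_cls, corollaFunctional_cls,
    corollaFunctional_cls]
  have h : ∀ c d e : ℤ, c = 1 → d = 1 → e = 1 → ((c : K) + d + e) = 3 := by
    rintro c d e rfl rfl rfl
    norm_num
  apply h
  all_goals
    rw [corollaWeight_vec]
    decide +kernel

end identity

/-! ### Graphs whose edges are formal linear combinations -/

section multilinear

variable (K : Type*) [Field K] {n m e n' m' : ℕ}

/-- Formal linear combinations of directed edges. -/
abbrev EdgeVec (n m : ℕ) : Type _ := Vert n m × Vert n m → K

theorem exists_multiCls (n m e : ℕ) :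
    ∃ f : MultilinearMap K (fun _ : Fin e => EdgeVec K n m) (DGraphs K n),
      ∀ x, f x = ∑ F : Edges n m e, (∏ a, x a (F a)) • cls K F := by
  refine ⟨∑ F : Edges n m e, (MultilinearMap.mkPiRing K (Fin e) (cls K F)).compLinearMap
    fun a => LinearMap.proj (F a), fun x => ?_⟩
  simp

/-- The multilinear extension of the class of a graph to formal linear combinations of edges. -/
noncomputable def multiCls (n m e : ℕ) :
    MultilinearMap K (fun _ : Fin e => EdgeVec K n m) (DGraphs K n) :=
  (exists_multiCls K n m e).choose

theorem multiCls_apply (x : Fin e → EdgeVec K n m) :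
    multiCls K n m e x = ∑ F : Edges n m e, (∏ a, x a (F a)) • cls K F :=
  (exists_multiCls K n m e).choose_spec x

theorem prod_single_edges (E F : Edges n m e) :
    ∏ a, (Pi.single (E a) 1 : EdgeVec K n m) (F a) = if F = E then 1 else 0 := by
  split_ifs with h
  · subst h
    simp
  · obtain ⟨a, ha⟩ := Function.ne_iff.1 h
    exact Finset.prod_eq_zero (Finset.mem_univ a) (Pi.single_eq_of_ne ha _)

theorem multiCls_single (E : Edges n m e) :
    multiCls K n m e (fun a => Pi.single (E a) 1) = cls K E := by
  rw [multiCls_apply, Finset.sum_eq_single E]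
  · simp
  · intro F _ hF
    rw [prod_single_edges, if_neg hF, zero_smul]
  · simp

theorem multiCls_eq_zero {x : Fin e → EdgeVec K n m}
    (hx : ∀ F : Edges n m e, (∀ a, x a (F a) ≠ 0) → ¬ Admissible F) : multiCls K n m e x = 0 := by
  rw [multiCls_apply]
  refine Finset.sum_eq_zero fun F _ => ?_
  by_cases h : ∀ a, x a (F a) ≠ 0
  · rw [cls_of_not K (hx F h), smul_zero]
  · push Not at h
    obtain ⟨a, ha⟩ := h
    rw [Finset.prod_eq_zero (Finset.mem_univ a) ha, zero_smul]

theorem multiCls_comp_perm (x : Fin e → EdgeVec K n m) (σ : Equiv.Perm (Fin e)) :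
    multiCls K n m e (x ∘ σ) = (Equiv.Perm.sign σ : ℤ) • multiCls K n m e x := by
  rw [multiCls_apply, multiCls_apply, Finset.smul_sum]
  symm
  -- Reindex the edge lists by `F ↦ F ∘ σ`; the product of the coefficients is unchanged.
  refine Fintype.sum_equiv (Equiv.arrowCongr σ.symm (Equiv.refl _)) _ _ fun F => ?_
  have h : (Equiv.arrowCongr σ.symm (Equiv.refl _)) F = F ∘ σ := rfl
  rw [h, cls_comp_perm, smul_comm]
  congr 1
  exact (Equiv.prod_comp σ fun a => x a (F a)).symm

/-- The pullback of edges along a map of vertices. -/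
def pullEdge (f : Vert n' m' → Vert n m) (x : EdgeVec K n m) : EdgeVec K n' m' :=
  fun p => x (Prod.map f f p)

/-- The image of edges under a map of vertices. -/
def pushEdge (g : Vert n m → Vert n' m') (y : EdgeVec K n m) : EdgeVec K n' m' :=
  fun p => ∑ q, if Prod.map g g q = p then y q else 0

theorem multiCls_relabel (x : Fin e → EdgeVec K n m) (τ : Equiv.Perm (Fin m)) :
    multiCls K n m e (fun a => pullEdge K (Sum.map id τ) (x a)) = multiCls K n m e x := by
  rw [multiCls_apply, multiCls_apply]
  let ρ : Vert n m ≃ Vert n m := Equiv.sumCongr (Equiv.refl _) τ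
  refine Fintype.sum_equiv (Equiv.arrowCongr (Equiv.refl _) (Equiv.prodCongr ρ ρ)) _ _ fun F => ?_
  exact congrArg _ (cls_relabel K F τ).symm

/-- Expanding a product of sums over preimages of each edge gives a sum over preimages of the whole
graph. -/
theorem prod_pushEdge (g : Vert n m → Vert n' m') (y : Fin e → EdgeVec K n m)
    (F : Edges n' m' e) :
    ∏ a, pushEdge K g (y a) (F a) = ∑ G : Edges n m e, if mapV g G = F then ∏ a, y a (G a) else 0 := by
  simp only [pushEdge]
  rw [Finset.prod_univ_sum, Fintype.piFinset_univ]
  refine Finset.sum_congr rfl fun G _ => ?_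
  rw [Finset.prod_ite_zero]
  congr 1
  simp [funext_iff, mapV]

theorem multiCls_append {e' : ℕ} (x : Fin e → EdgeVec K n m) (y : Fin e' → EdgeVec K n m) :
    multiCls K n m (e + e') (Fin.append x y)
      = ∑ F : Edges n m e, ∑ G : Edges n m e',
        ((∏ a, x a (F a)) * ∏ b, y b (G b)) • cls K (Fin.append F G) := by
  rw [multiCls_apply, ← Fintype.sum_prod_type']
  symm
  refine Fintype.sum_equiv (Fin.appendEquiv e e') _ _ fun p => ?_
  simp [Fin.appendEquiv, Fin.prod_univ_add]

/-- Edges are reconnected independently of each other, so summing over all reconnections is the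
pullback of each edge along the collapse map. The hypotheses concern every graph in the support,
admissible or not: for those without loops and double edges, and connected on the right,
`circ_cls_cls` still computes the composition. -/
theorem circ_multiCls {r s t : ℕ} (h : r + s = t) (j : Fin (r + 1)) {m m' e e' : ℕ}
    (x : Fin e → EdgeVec K (r + 1) m) (y : Fin e' → EdgeVec K (s + 1) m')
    (hx : ∀ F : Edges (r + 1) m e, (∀ a, x a (F a) ≠ 0) →
      (∀ a, (F a).1 ≠ (F a).2) ∧ Function.Injective F)
    (hy : ∀ F : Edges (s + 1) m' e', (∀ a, y a (F a) ≠ 0) →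
      (∀ a, (F a).1 ≠ (F a).2) ∧ Function.Injective F ∧ ConnectedToExternal F) :
    circ K h j (multiCls K _ _ _ x) (multiCls K _ _ _ y)
      = multiCls K (t + 1) (m + m') (e + e')
        (Fin.append (fun a => pullEdge K (collapse h j m m') (x a))
          fun b => pushEdge K (embed h j m m') (y b)) := by
  have h1 : ∀ (F : Edges (r + 1) m e) (G : Edges (s + 1) m' e'),
      ((∏ a, x a (F a)) * ∏ b, y b (G b)) • circ K h j (cls K F) (cls K G)
        = ((∏ a, x a (F a)) * ∏ b, y b (G b)) • insertSum K h j F G := by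
    intro F G
    by_cases hF : ∏ a, x a (F a) = 0
    · rw [hF, zero_mul, zero_smul, zero_smul]
    by_cases hG : ∏ a, y a (G a) = 0
    · rw [hG, mul_zero, zero_smul, zero_smul]
    have hF' := hx F fun a => (Finset.prod_ne_zero_iff.1 hF) a (Finset.mem_univ a)
    have hG' := hy G fun a => (Finset.prod_ne_zero_iff.1 hG) a (Finset.mem_univ a)
    rw [circ_cls_cls K h j hF'.1 hF'.2 hG'.1 hG'.2.1 hG'.2.2]
  have h2 : circ K h j (multiCls K _ _ _ x) (multiCls K _ _ _ y)
      = ∑ F, ∑ G, ((∏ a, x a (F a)) * ∏ b, y b (G b)) • insertSum K h j F G := by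
    rw [multiCls_apply, multiCls_apply, map_sum (circ K h j), LinearMap.sum_apply]
    refine Finset.sum_congr rfl fun F _ => ?_
    rw [map_sum]
    refine Finset.sum_congr rfl fun G _ => ?_
    rw [map_smul, map_smul, LinearMap.smul_apply, smul_smul, ← h1, mul_comm]
  rw [h2, multiCls_append]
  have h3 : ∀ H : Edges (t + 1) (m + m') e, ∑ G' : Edges (t + 1) (m + m') e',
      ((∏ a, pullEdge K (collapse h j m m') (x a) (H a)) *
        ∏ b, pushEdge K (embed h j m m') (y b) (G' b)) • cls K (Fin.append H G')
      = ∑ G : Edges (s + 1) m' e', ((∏ a, x a (mapV (collapse h j m m') H a)) * ∏ b, y b (G b)) •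
        cls K (Fin.append H (mapV (embed h j m m') G)) := by
    intro H
    simp only [prod_pushEdge, Finset.mul_sum, Finset.sum_smul]
    rw [Finset.sum_comm]
    refine Finset.sum_congr rfl fun G _ => ?_
    rw [Finset.sum_eq_single (mapV (embed h j m m') G)]
    · rw [if_pos rfl]
      rfl
    · intro G' _ hG'
      rw [if_neg hG'.symm, mul_zero, zero_smul]
    · simp
  -- Group the reconnected graphs by their contraction; each fiber is the set of lifts summed in
  -- `insertSum`.
  rw [Finset.sum_congr rfl fun H _ => h3 H,
    ← Finset.sum_fiberwise_of_maps_to (t := Finset.univ)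
      (g := fun H => mapV (collapse h j m m') H) fun _ _ => Finset.mem_univ _]
  refine Finset.sum_congr rfl fun F _ => ?_
  rw [Finset.sum_comm' (t' := Finset.univ) (s' := fun _ => lifts (collapse h j m m') F)]
  · refine Finset.sum_congr rfl fun G _ => ?_
    rw [insertSum, Finset.smul_sum]
    refine Finset.sum_congr rfl fun H hH => ?_
    rw [mem_lifts] at hH
    rw [hH]
  · intro H G
    simp [mem_lifts]

/-- The generalized IHX relation for formal linear combinations of edges. -/
theorem multiCls_ihx (v : Fin m) (x : Fin e → EdgeVec K n m)
    (hx : ∀ F : Edges n m e, (∀ a, x a (F a) ≠ 0) →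
      (∀ a, (F a).1 ≠ (F a).2) ∧ Function.Injective F) :
    multiCls K n (m + 1) (e + 1) (Fin.append (fun a => pullEdge K (merge v) (x a))
      fun _ : Fin 1 => Pi.single (Sum.inr v.castSucc, Sum.inr (Fin.last m)) 1) = 0 := by
  rw [multiCls_append]
  let G₀ : Edges n (m + 1) 1 := fun _ => (Sum.inr v.castSucc, Sum.inr (Fin.last m))
  have h3 : ∀ H : Edges n (m + 1) e, ∑ G : Edges n (m + 1) 1,
      ((∏ a, pullEdge K (merge v) (x a) (H a)) *
        ∏ b, (Pi.single (G₀ b) 1 : EdgeVec K n (m + 1)) (G b)) • cls K (Fin.append H G)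
      = (∏ a, x a (mapV (merge v) H a)) • cls K (addEdge v H) := by
    intro H
    simp only [prod_single_edges]
    rw [Finset.sum_eq_single G₀]
    · rw [if_pos rfl, mul_one, addEdge, Fin.append_right_eq_snoc]
      rfl
    · intro G _ hG
      rw [if_neg hG, mul_zero, zero_smul]
    · simp
  refine (Finset.sum_congr rfl fun H _ => h3 H).trans ?_
  rw [← Finset.sum_fiberwise_of_maps_to (t := Finset.univ)
      (g := fun H => mapV (merge v) H) fun _ _ => Finset.mem_univ _]
  refine Finset.sum_eq_zero fun F _ => ?_
  by_cases hF : ∏ a, x a (F a) = 0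
  · refine Finset.sum_eq_zero fun H hH => ?_
    rw [(Finset.mem_filter.1 hH).2, hF, zero_smul]
  -- The coefficient is constant on the fiber over `F`, so it factors out of one ordinary IHX sum.
  · have hF' := hx F fun a => (Finset.prod_ne_zero_iff.1 hF) a (Finset.mem_univ a)
    have := sum_cls_addEdge K v hF'.2 hF'.1
    rw [lifts] at this
    calc _ = ∑ H with mapV (merge v) H = F, (∏ a, x a (F a)) • cls K (addEdge v H) := by
          refine Finset.sum_congr rfl fun H hH => ?_
          rw [(Finset.mem_filter.1 hH).2]
      _ = 0 := by rw [← Finset.smul_sum, this, smul_zero]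

/-- The sum of the two directions of an edge. -/
def edgeSum (x y : Vert n m) : EdgeVec K n m := Pi.single (x, y) 1 + Pi.single (y, x) 1

theorem edgeSum_ne_zero {x y : Vert n m} {p : Vert n m × Vert n m} (h : edgeSum K x y p ≠ 0) :
    p = (x, y) ∨ p = (y, x) := by
  by_contra hp
  push Not at hp
  exact h (by simp [edgeSum, Pi.single_eq_of_ne hp.1, Pi.single_eq_of_ne hp.2])

theorem edgeSum_comm (x y : Vert n m) : edgeSum K x y = edgeSum K y x := add_comm _ _

/-- The endpoint over `x` has only one choice, so reconnecting means letting the other endpoint run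
through the fiber of `y`. -/
theorem pullEdge_edgeSum (f : Vert n' m' → Vert n m) {x : Vert n m} {y : Vert n m}
    {x' : Vert n' m'} (hx : ∀ z, f z = x ↔ z = x') :
    pullEdge K f (edgeSum K x y) = ∑ y' with f y' = y, edgeSum K x' y' := by
  funext ⟨p, q⟩
  simp only [pullEdge, edgeSum, Pi.add_apply, Finset.sum_apply, Finset.sum_add_distrib,
    Prod.map_apply, Pi.single_apply, Prod.mk.injEq, hx]
  have key : ∀ p q : Vert n' m', (if p = x' ∧ f q = y then 1 else 0 : K)
      = ∑ y' with f y' = y, if p = x' ∧ q = y' then 1 else 0 := by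
    intro p q
    rw [Finset.sum_filter]
    refine ((Fintype.sum_eq_single q fun b hb => ?_).trans ?_).symm
    · simp [hb.symm]
    · simp only [← ite_and, and_comm, true_and]
  rw [key]
  congr 1
  refine Eq.trans ?_ ((key q p).trans ?_)
  · simp only [and_comm]
  · simp only [and_comm]

theorem pushEdge_edgeSum (g : Vert n m → Vert n' m') (x y : Vert n m) :
    pushEdge K g (edgeSum K x y) = edgeSum K (g x) (g y) := by
  funext p
  have key : ∀ x y : Vert n m, ∑ q, (if Prod.map g g q = p then
      (Pi.single (x, y) 1 : EdgeVec K n m) q else 0) = (Pi.single (g x, g y) 1 : EdgeVec K n' m') p := by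
    intro x y
    refine (Fintype.sum_eq_single (x, y) fun b hb => ?_).trans ?_
    · simp [Pi.single_eq_of_ne hb]
    · simp [Pi.single_apply, eq_comm]
  simp only [pushEdge, edgeSum, Pi.add_apply]
  simp only [ite_add_zero, Finset.sum_add_distrib, key]

end multilinear

/-! ### Closedness of the corolla and conclusion -/

section cocycle

variable (K : Type*) [Field K]

/-- One incoming plus two outgoing edges bound the valence of an internal vertex. -/
theorem card_edges_le_three {n m e : ℕ} {F : Edges n m e} (hF : Admissible F) (i : Fin m)
    (h : ∀ a, (F a).1 = Sum.inr i ∨ (F a).2 = Sum.inr i) : e ≤ 3 := by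
  have h1 : (Finset.univ : Finset (Fin e)) ⊆ (Finset.univ.filter fun a => (F a).1 = Sum.inr i)
      ∪ (Finset.univ.filter fun a => (F a).2 = Sum.inr i) := by
    intro a _
    simpa using h a
  have h2 := (Finset.card_le_card h1).trans (Finset.card_union_le _ _)
  have h3 := hF.inDeg_le i
  have h4 := hF.outDeg_le i
  rw [inDeg] at h3
  rw [outDeg] at h4
  rw [Finset.card_univ, Fintype.card_fin] at h2
  omega

theorem edgeSum_support {n m e : ℕ} {v : Fin m} {k : Fin e → Fin n} {F : Edges n m e}
    (hF : ∀ a, edgeSum K (Sum.inr v) (Sum.inl (k a)) (F a) ≠ 0) (a : Fin e) :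
    F a = (Sum.inr v, Sum.inl (k a)) ∨ F a = (Sum.inl (k a), Sum.inr v) :=
  edgeSum_ne_zero K (hF a)

theorem noLoop_of_edgeSum {n m e : ℕ} {v : Fin m} {k : Fin e → Fin n} (hk : Function.Injective k)
    {F : Edges n m e} (hF : ∀ a, edgeSum K (Sum.inr v) (Sum.inl (k a)) (F a) ≠ 0) :
    (∀ a, (F a).1 ≠ (F a).2) ∧ Function.Injective F := by
  refine ⟨fun a => ?_, fun a b hab => hk ?_⟩
  · rcases edgeSum_support K hF a with h | h <;> simp [h]
  · rcases edgeSum_support K hF a with h | h <;> rcases edgeSum_support K hF b with h' | h' <;>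
      simp_all

theorem connected_of_edgeSum {n e : ℕ} {k : Fin (e + 1) → Fin n} {F : Edges n 1 (e + 1)}
    (hF : ∀ a, edgeSum K (Sum.inr 0) (Sum.inl (k a)) (F a) ≠ 0) : ConnectedToExternal F := by
  intro i
  rw [Subsingleton.elim i 0]
  refine ⟨k 0, .single ⟨0, ?_⟩⟩
  rcases edgeSum_support K hF 0 with h | h
  · exact Or.inl h
  · exact Or.inr h

section vectors

variable {n m : ℕ} (x y z w x' : EdgeVec K n m)

/-- `multiCls` for three edges. -/
noncomputable def threeCls : DGraphs K n := multiCls K n m 3 ![x, y, z]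

/-- `multiCls` for four edges. -/
noncomputable def fourCls : DGraphs K n := multiCls K n m 4 ![x, y, z, w]

theorem multiCls_add {e : ℕ} (X : Fin e → EdgeVec K n m) (i : Fin e) {X₁ X₂ : Fin e → EdgeVec K n m}
    {x x' : EdgeVec K n m} (h : X = Function.update X i (x + x')) (h₁ : X₁ = Function.update X i x)
    (h₂ : X₂ = Function.update X i x') :
    multiCls K n m e X = multiCls K n m e X₁ + multiCls K n m e X₂ := by
  rw [h, MultilinearMap.map_update_add, h₁, h₂]

theorem threeCls_add₀ : threeCls K (x + x') y z = threeCls K x y z + threeCls K x' y z :=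
  multiCls_add K _ 0 (by funext a; fin_cases a <;> rfl) (by funext a; fin_cases a <;> rfl)
    (by funext a; fin_cases a <;> rfl)

theorem threeCls_add₁ : threeCls K x (y + x') z = threeCls K x y z + threeCls K x x' z :=
  multiCls_add K _ 1 (by funext a; fin_cases a <;> rfl) (by funext a; fin_cases a <;> rfl)
    (by funext a; fin_cases a <;> rfl)

theorem threeCls_add₂ : threeCls K x y (z + x') = threeCls K x y z + threeCls K x y x' :=
  multiCls_add K _ 2 (by funext a; fin_cases a <;> rfl) (by funext a; fin_cases a <;> rfl)
    (by funext a; fin_cases a <;> rfl)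

theorem fourCls_add₀ : fourCls K (x + x') y z w = fourCls K x y z w + fourCls K x' y z w :=
  multiCls_add K _ 0 (by funext a; fin_cases a <;> rfl) (by funext a; fin_cases a <;> rfl)
    (by funext a; fin_cases a <;> rfl)

theorem fourCls_add₁ : fourCls K x (y + x') z w = fourCls K x y z w + fourCls K x x' z w :=
  multiCls_add K _ 1 (by funext a; fin_cases a <;> rfl) (by funext a; fin_cases a <;> rfl)
    (by funext a; fin_cases a <;> rfl)

theorem fourCls_add₂ : fourCls K x y (z + x') w = fourCls K x y z w + fourCls K x y x' w :=
  multiCls_add K _ 2 (by funext a; fin_cases a <;> rfl) (by funext a; fin_cases a <;> rfl)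
    (by funext a; fin_cases a <;> rfl)

theorem fourCls_add₃ : fourCls K x y z (w + x') = fourCls K x y z w + fourCls K x y z x' :=
  multiCls_add K _ 3 (by funext a; fin_cases a <;> rfl) (by funext a; fin_cases a <;> rfl)
    (by funext a; fin_cases a <;> rfl)

theorem fourCls_swap₀₃ : fourCls K x y z w = - fourCls K w y z x := by
  have := multiCls_comp_perm K ![w, y, z, x] (Equiv.swap 0 3)
  rw [Equiv.Perm.sign_swap (by decide), Units.val_neg, Units.val_one, neg_one_smul] at this
  refine Eq.trans (congrArg (multiCls K n m 4) ?_) this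
  funext a
  fin_cases a <;> rfl

theorem fourCls_swap₁₃ : fourCls K x y z w = - fourCls K x w z y := by
  have := multiCls_comp_perm K ![x, w, z, y] (Equiv.swap 1 3)
  rw [Equiv.Perm.sign_swap (by decide), Units.val_neg, Units.val_one, neg_one_smul] at this
  refine Eq.trans (congrArg (multiCls K n m 4) ?_) this
  funext a
  fin_cases a <;> rfl

theorem fourCls_swap₂₃ : fourCls K x y z w = - fourCls K x y w z := by
  have := multiCls_comp_perm K ![x, y, w, z] (Equiv.swap 2 3)
  rw [Equiv.Perm.sign_swap (by decide), Units.val_neg, Units.val_one, neg_one_smul] at this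
  refine Eq.trans (congrArg (multiCls K n m 4) ?_) this
  funext a
  fin_cases a <;> rfl

/-- A cyclic rotation of four edges is an odd permutation. -/
theorem fourCls_rotate : fourCls K x y z w = - fourCls K w x y z := by
  rw [fourCls_swap₂₃, fourCls_swap₁₃ K x y w z, fourCls_swap₂₃ K x z w y,
    fourCls_swap₀₃ K x z y w, fourCls_swap₁₃ K w z y x, fourCls_swap₂₃ K w x y z]
  simp

end vectors

theorem graphA₁_eq : graphA₁ K
    = multiCls K 1 1 1 fun a => edgeSum K (Sum.inr 0) (Sum.inl ((![0] : Fin 1 → Fin 1) a)) := by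
  rw [graphA₁, ← multiCls_single, ← multiCls_single]
  symm
  refine multiCls_add K _ 0 (x := Pi.single (Sum.inr 0, Sum.inl 0) 1)
    (x' := Pi.single (Sum.inl 0, Sum.inr 0) 1) ?_ ?_ ?_ <;> funext a <;> fin_cases a <;> rfl

theorem graphA₂_eq : graphA₂ K = multiCls K 2 0 0 ![] := by
  rw [graphA₂, ← multiCls_single]
  congr 1
  funext a
  exact a.elim0

theorem threeCls_single {n m : ℕ} (p q r : Vert n m × Vert n m) :
    threeCls K (Pi.single p 1) (Pi.single q 1) (Pi.single r 1) = cls K ![p, q, r] := by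
  rw [← multiCls_single, threeCls]
  congr 1
  funext a
  fin_cases a <;> rfl

/-- Of the eight orientations of the legs, the one with three outgoing edges and the four with at
least two incoming edges are not admissible; the other three are the summands of b. -/
theorem graphB_eq : graphB K = multiCls K 3 1 3 fun a => edgeSum K (Sum.inr 0) (Sum.inl (id a)) := by
  have h : (fun a => edgeSum K (Sum.inr 0) (Sum.inl (id a)) : Fin 3 → EdgeVec K 3 1)
      = ![edgeSum K (Sum.inr 0) (Sum.inl 0), edgeSum K (Sum.inr 0) (Sum.inl 1),
        edgeSum K (Sum.inr 0) (Sum.inl 2)] := by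
    funext a
    fin_cases a <;> rfl
  rw [h, ← threeCls]
  simp only [edgeSum, threeCls_add₀, threeCls_add₁, threeCls_add₂, threeCls_single]
  rw [cls_of_not K (E := ![(Sum.inr 0, Sum.inl 0), (Sum.inr 0, Sum.inl 1), (Sum.inr 0, Sum.inl 2)])
      fun h => absurd (h.outDeg_le 0) (by decide),
    cls_of_not K (E := ![(Sum.inr 0, Sum.inl 0), (Sum.inl 1, Sum.inr 0), (Sum.inl 2, Sum.inr 0)])
      fun h => absurd (h.inDeg_le 0) (by decide),
    cls_of_not K (E := ![(Sum.inl 0, Sum.inr 0), (Sum.inr 0, Sum.inl 1), (Sum.inl 2, Sum.inr 0)])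
      fun h => absurd (h.inDeg_le 0) (by decide),
    cls_of_not K (E := ![(Sum.inl 0, Sum.inr 0), (Sum.inl 1, Sum.inr 0), (Sum.inr 0, Sum.inl 2)])
      fun h => absurd (h.inDeg_le 0) (by decide),
    cls_of_not K (E := ![(Sum.inl 0, Sum.inr 0), (Sum.inl 1, Sum.inr 0), (Sum.inl 2, Sum.inr 0)])
      fun h => absurd (h.inDeg_le 0) (by decide), graphB]
  abel

theorem pullEdge_of_bijOn {n m n' m' : ℕ} {f : Vert n' m' → Vert n m} {x y : Vert n m}
    {x' y' : Vert n' m'} (hx : ∀ z, f z = x ↔ z = x') (hy : ∀ z, f z = y ↔ z = y') :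
    pullEdge K f (edgeSum K x y) = edgeSum K x' y' := by
  rw [pullEdge_edgeSum K f hx]
  simp [hy, Finset.filter_eq']

theorem pullEdge_of_pair {n m n' m' : ℕ} {f : Vert n' m' → Vert n m} {x y : Vert n m}
    {x' y' y'' : Vert n' m'} (hx : ∀ z, f z = x ↔ z = x') (hne : y' ≠ y'')
    (hy : ∀ z, f z = y ↔ z = y' ∨ z = y'') :
    pullEdge K f (edgeSum K x y) = edgeSum K x' y' + edgeSum K x' y'' := by
  rw [pullEdge_edgeSum K f hx]
  have : (Finset.univ.filter fun z => f z = y) = {y', y''} := by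
    ext z
    simp [hy]
  rw [this, Finset.sum_pair hne]

theorem pullEdge_single {n m n' m' : ℕ} {f : Vert n' m' → Vert n m} {x y : Vert n m}
    {x' y' : Vert n' m'} (hx : ∀ z, f z = x ↔ z = x') (hy : ∀ z, f z = y ↔ z = y') :
    pullEdge K f (Pi.single (x, y) 1) = Pi.single (x', y') 1 := by
  funext p
  simp [pullEdge, Pi.single_apply, Prod.ext_iff, hx, hy]

/-- The leg joining the internal vertex `i` with the external vertex `k`. -/
abbrev leg {n m : ℕ} (i : Fin m) (k : Fin n) : EdgeVec K n m := edgeSum K (Sum.inr i) (Sum.inl k)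

theorem graphB_circ_graphA₁ (j : Fin 3) :
    circ K (rfl : 2 + 0 = 2) j (graphB K) (graphA₁ K)
      = fourCls K (m := 2) (pullEdge K (collapse (rfl : 2 + 0 = 2) j 1 1) (leg K (0 : Fin 1) 0))
        (pullEdge K (collapse (rfl : 2 + 0 = 2) j 1 1) (leg K (0 : Fin 1) 1))
        (pullEdge K (collapse (rfl : 2 + 0 = 2) j 1 1) (leg K (0 : Fin 1) 2)) (leg K 1 j) := by
  rw [graphB_eq, graphA₁_eq, circ_multiCls K _ _ _ _
    (fun F hF => noLoop_of_edgeSum K Function.injective_id hF)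
    (fun F hF => (noLoop_of_edgeSum K (Function.injective_of_subsingleton (α := Fin 1) _) hF).imp_right
      fun h => ⟨h, connected_of_edgeSum K hF⟩)]
  rw [fourCls]
  refine congrArg (multiCls K 3 2 4) ?_
  simp only [pushEdge_edgeSum]
  funext a
  fin_cases a <;> rfl

/-- When a₁ is inserted at `j`, only the leg at `j` has a choice: it ends at the external vertex or
at the new internal vertex of a₁. -/
theorem pullEdge_collapse_leg : ∀ j k : Fin 3,
    pullEdge K (collapse (rfl : 2 + 0 = 2) j 1 1) (leg K (0 : Fin 1) k)
      = if k = j then leg K (0 : Fin 2) j + edgeSum K (Sum.inr 0) (Sum.inr 1)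
        else leg K (0 : Fin 2) k := by
  intro j k
  split_ifs with h
  · subst h
    refine pullEdge_of_pair K ?_ (by simp) ?_ <;> revert k <;> decide
  · refine pullEdge_of_bijOn K ?_ ?_ <;> revert j k <;> decide

theorem graphA₁_circ_graphB :
    circ K (rfl : 0 + 2 = 2) 0 (graphA₁ K) (graphB K)
      = fourCls K (m := 2) (leg K 0 0 + leg K 0 1 + leg K 0 2 + edgeSum K (Sum.inr 0) (Sum.inr 1))
        (leg K 1 0) (leg K 1 1) (leg K 1 2) := by
  rw [graphB_eq, graphA₁_eq, circ_multiCls K _ _ _ _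
    (fun F hF => noLoop_of_edgeSum K (Function.injective_of_subsingleton (α := Fin 1) _) hF)
    (fun F hF => (noLoop_of_edgeSum K Function.injective_id hF).imp_right
      fun h => ⟨h, connected_of_edgeSum K hF⟩)]
  have h : pullEdge K (collapse (rfl : 0 + 2 = 2) 0 1 1) (leg K (0 : Fin 1) (0 : Fin 1))
      = leg K (0 : Fin 2) 0 + leg K 0 1 + leg K 0 2 + edgeSum K (Sum.inr 0) (Sum.inr 1) := by
    rw [pullEdge_edgeSum K _ (x' := Sum.inr 0) (by decide)]
    have : (Finset.univ.filter fun z => collapse (rfl : 0 + 2 = 2) 0 1 1 z = Sum.inl 0)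
        = {Sum.inl 0, Sum.inl 1, Sum.inl 2, Sum.inr 1} := by decide
    rw [this, Finset.sum_insert (by decide), Finset.sum_insert (by decide),
      Finset.sum_insert (by decide), Finset.sum_singleton]
    exact ((add_assoc _ _ _).trans (add_assoc _ _ _)).symm
  rw [← h]
  rw [fourCls]
  refine congrArg (multiCls K 3 2 4) ?_
  simp only [pushEdge_edgeSum]
  funext a
  fin_cases a <;> rfl

theorem fourCls_relabel (x y z w : EdgeVec K 3 2) :
    fourCls K (pullEdge K (Sum.map id (Equiv.swap 0 1)) x)
      (pullEdge K (Sum.map id (Equiv.swap 0 1)) y) (pullEdge K (Sum.map id (Equiv.swap 0 1)) z)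
      (pullEdge K (Sum.map id (Equiv.swap 0 1)) w) = fourCls K x y z w := by
  refine Eq.trans (congrArg (multiCls K 3 2 4) ?_)
    (multiCls_relabel K ![x, y, z, w] (Equiv.swap 0 1))
  funext a
  fin_cases a <;> rfl

theorem pullEdge_swap_leg_zero (k : Fin 3) :
    pullEdge K (Sum.map id (Equiv.swap (0 : Fin 2) 1)) (leg K (0 : Fin 2) k) = leg K 1 k := by
  refine pullEdge_of_bijOn K ?_ ?_ <;> revert k <;> decide

theorem pullEdge_swap_leg_one (k : Fin 3) :
    pullEdge K (Sum.map id (Equiv.swap (0 : Fin 2) 1)) (leg K (1 : Fin 2) k) = leg K 0 k := by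
  refine pullEdge_of_bijOn K ?_ ?_ <;> revert k <;> decide

/-- All four edges meet the internal vertex `i`, which has valence at most three in an admissible
graph. -/
theorem fourCls_eq_zero (i : Fin 2) {x y z w : EdgeVec K 3 2}
    (hx : ∀ p, x p ≠ 0 → p.1 = Sum.inr i ∨ p.2 = Sum.inr i)
    (hy : ∀ p, y p ≠ 0 → p.1 = Sum.inr i ∨ p.2 = Sum.inr i)
    (hz : ∀ p, z p ≠ 0 → p.1 = Sum.inr i ∨ p.2 = Sum.inr i)
    (hw : ∀ p, w p ≠ 0 → p.1 = Sum.inr i ∨ p.2 = Sum.inr i) : fourCls K x y z w = 0 := by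
  refine multiCls_eq_zero K fun F hF hadm => absurd (card_edges_le_three hadm i fun a => ?_)
    (by norm_num)
  have := hF a
  fin_cases a
  · exact hx _ this
  · exact hy _ this
  · exact hz _ this
  · exact hw _ this

theorem edgeSum_left {n m : ℕ} {x y : Vert n m} (p : Vert n m × Vert n m)
    (h : edgeSum K x y p ≠ 0) : p.1 = x ∨ p.2 = x := by
  rcases edgeSum_ne_zero K h with h | h <;> simp [h]

theorem edgeSum_right {n m : ℕ} {x y : Vert n m} (p : Vert n m × Vert n m)
    (h : edgeSum K x y p ≠ 0) : p.1 = y ∨ p.2 = y := by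
  rcases edgeSum_ne_zero K h with h | h <;> simp [h]

/-- The generalized IHX relation of the trivalent internal vertex. -/
theorem fourCls_ihx :
    let d : EdgeVec K 3 2 := edgeSum K (Sum.inr 0) (Sum.inr 1)
    fourCls K (leg K 1 0) (leg K 0 1) (leg K 0 2) d
      + fourCls K (leg K 0 0) (leg K 1 1) (leg K 0 2) d
      + fourCls K (leg K 0 0) (leg K 0 1) (leg K 1 2) d = 0 := by
  intro d
  have key := multiCls_ihx K (0 : Fin 1) (fun a : Fin 3 => edgeSum K (Sum.inr 0) (Sum.inl (id a)))
    fun F hF => noLoop_of_edgeSum K Function.injective_id hF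
  let s : EdgeVec K 3 2 := Pi.single (Sum.inr 0, Sum.inr 1) 1
  let s' : EdgeVec K 3 2 := Pi.single (Sum.inr 1, Sum.inr 0) 1
  have hs : ∀ i, ∀ p, s p ≠ 0 → p.1 = Sum.inr i ∨ p.2 = Sum.inr i := by
    intro i p hp
    have : p = (Sum.inr 0, Sum.inr 1) := by
      by_contra h
      exact hp (Pi.single_eq_of_ne h _)
    subst this
    fin_cases i <;> simp
  have hm : ∀ k : Fin 3, pullEdge K (merge (0 : Fin 1)) (edgeSum K (Sum.inr (0 : Fin 1)) (Sum.inl k))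
      = leg K (0 : Fin 2) k + leg K (1 : Fin 2) k := by
    intro k
    rw [edgeSum_comm, pullEdge_of_pair K (x' := Sum.inl k) (y' := Sum.inr 0) (y'' := Sum.inr 1),
      edgeSum_comm, edgeSum_comm K (Sum.inl k)] <;> revert k <;> decide
  have h0 : fourCls K (n := 3) (m := 2) (leg K 0 0 + leg K 1 0) (leg K 0 1 + leg K 1 1) (leg K 0 2 + leg K 1 2) s
      = 0 := by
    rw [← hm, ← hm, ← hm]
    refine Eq.trans (congrArg (multiCls K 3 2 4) ?_) key
    funext a
    fin_cases a <;> rfl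
  have hsw : pullEdge K (Sum.map id (Equiv.swap (0 : Fin 2) 1)) s = s' :=
    pullEdge_single K (by decide) (by decide)
  simp only [fourCls_add₀, fourCls_add₁, fourCls_add₂] at h0
  -- Of the eight distributions of the legs, those with all legs on one side vanish. In the three
  -- with two legs at vertex 1, exchanging the internal vertices moves these legs to vertex 0 and
  -- reverses the connecting edge; with the other three this yields the undirected edge `d`.
  rw [fourCls_eq_zero K 0 (edgeSum_left K) (edgeSum_left K) (edgeSum_left K) (hs 0),
    fourCls_eq_zero K 1 (edgeSum_left K) (edgeSum_left K) (edgeSum_left K) (hs 1),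
    ← fourCls_relabel K (leg K 1 0) (leg K 1 1) (leg K 0 2) s,
    ← fourCls_relabel K (leg K 1 0) (leg K 0 1) (leg K 1 2) s,
    ← fourCls_relabel K (leg K 0 0) (leg K 1 1) (leg K 1 2) s] at h0
  simp only [pullEdge_swap_leg_zero, pullEdge_swap_leg_one, hsw] at h0
  have hd : d = s + s' := rfl
  simp only [hd, fourCls_add₃]
  rw [← h0]
  abel

/-- Graphs with disconnected internal vertices, one univalent and one trivalent, occur on both sides
with the univalent leg first or last in the order, hence with opposite signs by `fourCls_rotate`.
The graphs containing the connecting edge add up to minus `fourCls_ihx`. -/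
theorem graphA₁_bracket_graphB :
    circ K (rfl : 0 + 2 = 2) 0 (graphA₁ K) (graphB K)
      + ∑ j : Fin 3, circ K (rfl : 2 + 0 = 2) j (graphB K) (graphA₁ K) = 0 := by
  have h1 : ∀ k : Fin 3, fourCls K (m := 2) (leg K 0 k) (leg K 1 0) (leg K 1 1) (leg K 1 2)
      = fourCls K (m := 2) (leg K 1 k) (leg K 0 0) (leg K 0 1) (leg K 0 2) := by
    intro k
    rw [← fourCls_relabel]
    simp only [pullEdge_swap_leg_zero, pullEdge_swap_leg_one]
  simp only [Fin.sum_univ_three, graphB_circ_graphA₁, graphA₁_circ_graphB, pullEdge_collapse_leg]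
  simp only [if_pos, Fin.reduceEq, if_false, fourCls_add₀, fourCls_add₁, fourCls_add₂, h1]
  rw [fourCls_eq_zero K 1 (edgeSum_right K) (edgeSum_left K) (edgeSum_left K)
      (edgeSum_left K), fourCls_rotate K _ _ _ (leg K (1 : Fin 2) 0), fourCls_rotate K _ _ _ (leg K (1 : Fin 2) 1),
    fourCls_rotate K (leg K (0 : Fin 2) 0) (leg K 0 1) (leg K 0 2) (leg K 1 2),
    fourCls_swap₀₃ K _ _ _ (leg K (1 : Fin 2) 0), fourCls_swap₁₃ K _ _ _ (leg K (1 : Fin 2) 1),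
    fourCls_swap₂₃ K _ _ _ (leg K (1 : Fin 2) 2)]
  refine Eq.trans ?_ ((congrArg Neg.neg (fourCls_ihx K)).trans neg_zero)
  abel

theorem graphB_circ_graphA₂ (j : Fin 3) :
    circ K (rfl : 2 + 1 = 3) j (graphB K) (graphA₂ K)
      = threeCls K (n := 4) (m := 1)
        (pullEdge K (collapse (rfl : 2 + 1 = 3) j 1 0) (leg K (0 : Fin 1) 0))
        (pullEdge K (collapse (rfl : 2 + 1 = 3) j 1 0) (leg K (0 : Fin 1) 1))
        (pullEdge K (collapse (rfl : 2 + 1 = 3) j 1 0) (leg K (0 : Fin 1) 2)) := by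
  rw [graphB_eq, graphA₂_eq, circ_multiCls K _ _ _ _
    (fun F hF => noLoop_of_edgeSum K Function.injective_id hF)
    (fun F hF => ⟨fun a => a.elim0, fun a => a.elim0, fun a => a.elim0⟩)]
  rw [threeCls]
  refine congrArg (multiCls K 4 1 3) ?_
  funext a
  fin_cases a <;> rfl

theorem pullEdge_collapse_leg_pair : ∀ j k : Fin 3,
    pullEdge K (collapse (rfl : 2 + 1 = 3) j 1 0) (leg K (0 : Fin 1) k)
      = if k = j then leg K (0 : Fin 1) j.castSucc + leg K (0 : Fin 1) j.succ
        else leg K (0 : Fin 1) (if k < j then k.castSucc else k.succ) := by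
  intro j k
  split_ifs with h h'
  · subst h
    refine pullEdge_of_pair K ?_ (by simp [Fin.ext_iff]) ?_ <;> revert k <;> decide
  · refine pullEdge_of_bijOn K ?_ ?_ <;> revert j k <;> decide
  · refine pullEdge_of_bijOn K ?_ ?_ <;> revert j k <;> decide

theorem graphA₂_circ_graphB (j : Fin 2) :
    circ K (rfl : 1 + 2 = 3) j (graphA₂ K) (graphB K)
      = threeCls K (n := 4) (m := 1) (leg K 0 ⟨j + 0, by omega⟩) (leg K 0 ⟨j + 1, by omega⟩)
        (leg K 0 ⟨j + 2, by omega⟩) := by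
  rw [graphB_eq, graphA₂_eq, circ_multiCls K _ _ _ _
    (fun F hF => ⟨fun a => a.elim0, fun a => a.elim0⟩)
    (fun F hF => (noLoop_of_edgeSum K Function.injective_id hF).imp_right
      fun h => ⟨h, connected_of_edgeSum K hF⟩)]
  rw [threeCls]
  refine congrArg (multiCls K 4 1 3) ?_
  simp only [pushEdge_edgeSum]
  funext a
  fin_cases a <;> rfl

/-- Let cᵢ be the undirected corolla on the four external vertices that omits `i`. Splitting vertex
`j` of b gives cⱼ + cⱼ₊₁, so the alternating sum telescopes to c₀ + c₃, the two insertions of b into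
a₂. -/
theorem graphA₂_bracket_graphB :
    ∑ j : Fin 3, (-1 : ℤ) ^ j.val • circ K (rfl : 2 + 1 = 3) j (graphB K) (graphA₂ K)
      = ∑ j : Fin 2, circ K (rfl : 1 + 2 = 3) j (graphA₂ K) (graphB K) := by
  simp only [graphB_circ_graphA₂, graphA₂_circ_graphB, pullEdge_collapse_leg_pair]
  simp [Fin.sum_univ_three, threeCls_add₀, threeCls_add₁, threeCls_add₂]
  abel

theorem ad_alphaZero_elementB : ad K 1 1 (alphaZero K) (elementB K) = 0 := by
  simp only [ad, alphaZero, elementB, map_add, LinearMap.add_apply, LinearMap.sub_apply,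
    LinearMap.smul_apply, LinearMap.flip_apply]
  rw [star_single_single K (rfl : 0 + 2 = 2), star_single_single K (rfl : 1 + 2 = 3),
    star_single_single K (rfl : 2 + 0 = 2), star_single_single K (rfl : 2 + 1 = 3)]
  have h1 := graphA₁_bracket_graphB K
  have h2 := graphA₂_bracket_graphB K
  have e1 : starTerm K (rfl : 0 + 2 = 2) 1 (graphA₁ K) (graphB K)
      = circ K (rfl : 0 + 2 = 2) 0 (graphA₁ K) (graphB K) := by
    simp [starTerm, Int.negOnePow_even _ (show Even (4 : ℤ) by decide)]
  have e2 : starTerm K (rfl : 2 + 0 = 2) 1 (graphB K) (graphA₁ K)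
      = ∑ j : Fin 3, circ K (rfl : 2 + 0 = 2) j (graphB K) (graphA₁ K) := by
    simp [starTerm, Int.negOnePow_even _ (show Even (-2 : ℤ) by decide)]
  have e3 : starTerm K (rfl : 1 + 2 = 3) 1 (graphA₂ K) (graphB K)
      = - ∑ j : Fin 2, circ K (rfl : 1 + 2 = 3) j (graphA₂ K) (graphB K) := by
    rw [starTerm, ← Finset.sum_neg_distrib]
    refine Finset.sum_congr rfl fun j _ => ?_
    rw [Int.negOnePow_odd, Units.val_neg, Units.val_one, neg_one_smul]
    exact ⟨j + 2, by push_cast; ring⟩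
  have e4 : starTerm K (rfl : 2 + 1 = 3) 1 (graphB K) (graphA₂ K)
      = ∑ j : Fin 3, (-1 : ℤ) ^ j.val • circ K (rfl : 2 + 1 = 3) j (graphB K) (graphA₂ K) := by
    rw [starTerm]
    refine Finset.sum_congr rfl fun j _ => ?_
    congr 1
    fin_cases j <;> decide
  have e5 : ((1 * 1 : ℤ).negOnePow : ℤ) = -1 := by decide
  -- Both elements have degree one, so the bracket is a sum of the two products, and the arity-three
  -- and arity-four parts cancel separately.
  rw [e1, e2, e3, e4, e5, neg_one_smul, sub_neg_eq_add, h2, eq_neg_of_add_eq_zero_left h1]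
  generalize (∑ j : Fin 3, circ K (rfl : 2 + 0 = 2) j (graphB K) (graphA₁ K)) = X
  generalize (∑ j : Fin 2, circ K (rfl : 1 + 2 = 3) j (graphA₂ K) (graphB K)) = Y
  change (Pi.single 2 (-X) + Pi.single 3 (-Y) + (Pi.single 2 X + Pi.single 3 Y) : GraphLie K) = 0
  rw [Pi.single_neg, Pi.single_neg]
  abel

theorem elementB_mem_homogeneous : elementB K ∈ homogeneous K 1 := by
  rw [homogeneous, Submodule.mem_pi]
  intro q _
  by_cases hq : q = 2
  · subst hq
    -- A nonzero corolla weight serves as a computable certificate of admissibility. The degree is 2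
    -- · 1 - 3 = -1.
    have key : ∀ E : Edges 3 1 3, corollaWeight E ≠ 0 → cls K E ∈ degreePart K 3 (1 - 2) :=
      fun E hE => Submodule.subset_span
        ⟨⟨1, 3, E, admissible_of_corollaWeight_ne_zero hE⟩, by norm_num, rfl⟩
    rw [elementB, Pi.single_eq_same, graphB]
    refine add_mem (add_mem (key _ ?_) (key _ ?_)) (key _ ?_) <;> rw [corollaWeight_vec] <;>
      decide +kernel
  · rw [elementB, Pi.single_eq_of_ne hq]
    exact zero_mem _

theorem elementB_mem_cocycles : elementB K ∈ cocycles K (alphaZero K) 1 :=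
  ⟨elementB_mem_homogeneous K, ad_alphaZero_elementB K⟩

/-- If b were a coboundary, `functional_ad_alphaZero` would give 2 · 3 + 0 = 0. -/
theorem elementB_notMem_coboundaries [CharZero K] :
    elementB K ∉ coboundaries K (alphaZero K) 1 := by
  rintro ⟨x, -, hx⟩
  have h := functional_ad_alphaZero K x
  rw [show (0 : ℤ) = 1 - 1 from rfl, hx] at h
  rw [elementB, Pi.single_eq_same, Pi.single_eq_of_ne (by decide), corollaFunctional_graphB, map_zero]
    at h
  norm_num at h

end cocycle

end DirGraphs

theorem mainTheorem5 (K : Type*) [Field K] [CharZero K] :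
    ∃ hb : DirGraphs.elementB K ∈ DirGraphs.cocycles K (DirGraphs.alphaZero K) 1,
      (Submodule.Quotient.mk ⟨DirGraphs.elementB K, hb⟩ :
        DirGraphs.Cohomology K (DirGraphs.alphaZero K) 1) ≠ 0 := by
  refine ⟨DirGraphs.elementB_mem_cocycles K, fun h => ?_⟩
  rw [Submodule.Quotient.mk_eq_zero] at h
  exact DirGraphs.elementB_notMem_coboundaries K h
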